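/- **Setting.** Let $\mathbb R_+=[0,\infty)$. A continuous function $g$ on an open subset of $\mathbb R_+^n$ is *standard analytic* at $a$ if near $a$ it is the restriction of a real analytic function of $\mathbb R^n$. It is *generalized analytic* at $a$ if near $a$ it is the sum of an absolutely convergent series $\sum_\mu s_\mu (y-a)^\mu$, $\mu\in\mathbb R_+^n$, whose support is contained in a product of $n$ well-ordered sets and in which $\mu_i\in\mathbb N$ whenever $s_\mu\neq0$ and $a_i\ne 0$. A standard (resp. generalized) analytic manifold of dimension $n$ is a second countable Hausdorff space $M$ with a subsheaf of the sheaf of continuous real functions which is locally isomorphic to $\mathbb R^n_+$ with its sheaf of standard (resp. generalized) analytic functions. If $\mathcal M=(M,\mathcal G)$ is generalized analytic, let $e(x)$ be the number of vanishing coordinates of $x$ in a chart; the strata are the connected components of the fibres of $e$, the boundary components $E_i$ ($i\in I$) are the closures of the strata with $e=1$, and the corner points are the points with $e=n$. For a corner point $p$ put $I_p=\{i\in I: p\in E_i\}$, and let $V_p^\star$ be the union of the strata whose closure contains $p$. An *affine chart* at $p$ is a chart $\mathbf x_p=(x_{p,i})_{i\in I_p}$ from $V_p^\star$ onto $\mathbb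 R_+^{I_p}$ with $\mathbf x_p(p)=0$ and $E_i\cap V_p^\star=\{x_{p,i}=0\}$. A *monomial generalized analytic manifold* $(\mathcal M,\mathfrak a)$ of dimension $n$ consists of a generalized analytic manifold $\mathcal M=(M,\mathcal G)$ of dimension $n$ with at least one corner point and with finitely many boundary components, every intersection $\bigcap_{j\in J}E_j$, $J\subset I$ (equal to $M$ for $J=\emptyset$), being connected or empty, and of an atlas $\mathfrak a=\{\mathbf x_p\}$ of $\mathcal M$ formed by one affine chart at each corner point, which is monomial: for all corner points $p,q$ there is a real matrix $C^{pq}$ with $x_{q,i}=\prod_{j\in I_p}x_{p,j}^{C^{pq}_{ij}}$ on $V_p^\star\cap V_q^\star$ for $i\in I_q$. Its *weight connexion functions* are $\gamma^{pq}_i=C^{pq}_{ii}$, $i\in I_p\cap I_q$. A *standardization* of $\mathcal M$ is a subsheaf $\mathcal O\subset\mathcal G$ such that $(M,\mathcal O)$ is a standard analytic manifold of dimension $n$ whose enrichment is $\mathcal M$: around each point there is a chart $\varphi$ of $(M,\mathcal O)$ in whose domain the sections of $\mathcal G$ are the functions $f$ with $f\circ\varphi^{-1}$ generalized analytic. A *local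 m-standardization* at a corner point $p$ is an affine chart $\mathbf u_p$ of $\mathcal M$ over $V_p^\star$ of the form $u_{p,i}=x_{p,i}^{\alpha_{p,i}}$ with $\alpha_{p,i}\in\mathbb R_{>0}$, $i\in I_p$. An *m-standardization* of $(\mathcal M,\mathfrak a)$ is a pair $(\mathcal O,\mathfrak b)$ with $\mathcal O$ a standardization of $\mathcal M$ and $\mathfrak b=\{\mathbf u_p\}_p$ a monomial atlas of $(M,\mathcal O)$ such that every $\mathbf u_p$ is a local m-standardization. It *extends* $\mathbf u_p$ if $\mathbf u_p\in\mathfrak b$; $\mathcal E(\mathbf u_p)$ is the set of the m-standardizations that extend $\mathbf u_p$. **Proposition 3.6.** Let $(\mathcal M,\mathfrak a)$ be a monomial generalized analytic manifold of dimension $n$ and $N=\#I$ the number of its boundary components. a) There is a bijection between the set of m-standardizations of $(\mathcal M,\mathfrak a)$ and $\mathbb R_{>0}^N$. More precisely, for any choice of corner points $q_i\in E_i$, $i\in I$, sending an m-standardization with exponents $\{\alpha_p\}_p$ to $(\alpha_{q_i,i})_{i\in I}$ is a bijection onto $\mathbb R_{>0}^I$. b) We have $n\le N$, and given a corner point $p$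 and a local m-standardization $\mathbf u_p$ at $p$, there is a bijection $\mathbb R_{>0}^{N-n}\to\mathcal E(\mathbf u_p)$. More precisely, for any choice of corner points $q_i\in E_i$, $i\in I\setminus I_p$, sending an extension to $(\alpha_{q_i,i})_{i\in I\setminus I_p}$ is a bijection onto $\mathbb R_{>0}^{I\setminus I_p}$. c) A collection $\{\alpha_p:I_p\to\mathbb R_{>0}\}_p$, $p$ running over the corner points, is the collection of exponents of an m-standardization if and only if $\alpha_{p,i}=\gamma^{pq}_i\,\alpha_{q,i}$ for all corner points $p,q$ and all $i\in I_p\cap I_q$. -/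

import Mathlib

open scoped NNReal Topology
open TopologicalSpace

namespace GenAnalytic

/-! ### Sheaves of continuous functions -/

/-- A subsheaf of the sheaf of continuous real functions on `M`. (For the structural sheaves of
manifolds below, the sections automatically form `ℝ`-algebras, since those of the local models
do.) -/
@[ext]
structure FunctionSheaf (M : Type*) [TopologicalSpace M] where
  sections : (U : Opens M) → Set C(U, ℝ)
  restrict_mem : ∀ {U V : Opens M} (h : V ≤ U) (f : C(U, ℝ)), f ∈ sections U →
    f.comp ⟨Set.inclusion h, continuous_inclusion h⟩ ∈ sections V
  locality : ∀ {U : Opens M} (f : C(U, ℝ)),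
    (∀ x ∈ U, ∃ (V : Opens M) (h : V ≤ U), x ∈ V ∧
      f.comp ⟨Set.inclusion h, continuous_inclusion h⟩ ∈ sections V) → f ∈ sections U

/-- `A` is a subsheaf of `B`. -/
def FunctionSheaf.IsSubsheaf {M : Type*} [TopologicalSpace M] (A B : FunctionSheaf M) : Prop :=
  ∀ U : Opens M, A.sections U ⊆ B.sections U

/-! ### Generalized power series and the two local models on `ℝ₊^ι = (ι → ℝ≥0)` -/

section Series

variable {ι : Type*} [Fintype ι]

/-- `s = ∑ s_μ X^μ`, `μ ∈ ℝ₊^ι`, is a formal generalized power series: its support is contained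
in a cartesian product of well-ordered sets. -/
def IsGenPowerSeries (s : (ι → ℝ≥0) → ℝ) : Prop :=
  ∃ W : ι → Set ℝ≥0, (∀ i, (W i).IsWF) ∧ Function.support s ⊆ Set.pi Set.univ W

/-- `‖s‖_ρ = ∑ |s_μ| ρ^μ < ∞` for some polyradius `ρ`. -/
def IsConvergentSeries (s : (ι → ℝ≥0) → ℝ) : Prop :=
  ∃ ρ : ι → ℝ, (∀ i, 0 < ρ i) ∧ Summable fun μ : ι → ℝ≥0 => |s μ| * ∏ i, ρ i ^ (μ i : ℝ)

/-- `s` is a mixed series: the exponents of the variables with index in `Y` are natural numbers. -/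
def IsMixedSeries (Y : Set ι) (s : (ι → ℝ≥0) → ℝ) : Prop :=
  ∀ μ : ι → ℝ≥0, s μ ≠ 0 → ∀ i ∈ Y, ∃ k : ℕ, μ i = (k : ℝ≥0)

/-- `g` is generalized analytic at `a ∈ ℝ₊^ι`: near `a` it is the sum of a convergent mixed
power series in the variables `y i - a i`, with natural exponents in those `i` for which
`a i ≠ 0` (only these differences can be negative) and real exponents `≥ 0` in the others.
It only depends on the germ of `g` at `a`. -/
def IsGenAnalyticAt (g : (ι → ℝ≥0) → ℝ) (a : ι → ℝ≥0) : Prop :=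
  ∃ s : (ι → ℝ≥0) → ℝ, IsGenPowerSeries s ∧ IsConvergentSeries s ∧
    IsMixedSeries {i | a i ≠ 0} s ∧
    ∀ᶠ y in 𝓝 a, HasSum (fun μ : ι → ℝ≥0 => s μ * ∏ i, ((y i : ℝ) - (a i : ℝ)) ^ (μ i : ℝ)) (g y)

/-- `g` is standard analytic at `a ∈ ℝ₊^ι`: its germ at `a` is the restriction of the germ of a
real analytic function of `ℝ^ι`. -/
def IsStdAnalyticAt (g : (ι → ℝ≥0) → ℝ) (a : ι → ℝ≥0) : Prop :=
  ∃ F : (ι → ℝ) → ℝ, AnalyticAt ℝ F (fun i => (a i : ℝ)) ∧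
    ∀ᶠ y in 𝓝 a, g y = F (fun i => (y i : ℝ))

/-- The two kinds of manifolds: standard analytic and generalized analytic. -/
inductive Kind
  | standard
  | generalized

/-- The germs of sections of the structural sheaf of the local model `ℝ₊^ι`. -/
def Kind.AnalyticAt : Kind → ((ι → ℝ≥0) → ℝ) → (ι → ℝ≥0) → Prop
  | .standard => IsStdAnalyticAt
  | .generalized => IsGenAnalyticAt

end Series

/-! ### Manifolds -/

section Manifolds

variable {M : Type*} [TopologicalSpace M]

/-- `(V, φ)` is a local chart of the `n`-dimensional space `(M, S)`, with coordinates indexed by an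
`n`-element set `ι`: `V` is open, `φ` is a homeomorphism of `V` onto an open subset of `ℝ₊^ι`, and
composition with `φ` identifies the sections of the local model with those of `S`. In the last
clause `g` stands for `f ∘ φ⁻¹`, which is defined on the open set `φ(U)`. -/
structure IsLocalChart (𝒜 : Kind) (n : ℕ) (S : FunctionSheaf M) {ι : Type*} [Fintype ι]
    (V : Set M) (φ : V → ι → ℝ≥0) : Prop where
  card_eq : Fintype.card ι = n
  isOpen : IsOpen V
  isOpenEmbedding : Topology.IsOpenEmbedding φ
  mem_sections_iff : ∀ (U : Opens M) (hU : (U : Set M) ⊆ V) (f : C(U, ℝ)),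
    f ∈ S.sections U ↔
      ∃ g : (ι → ℝ≥0) → ℝ, ∀ x : U, g (φ ⟨x, hU x.2⟩) = f x ∧ 𝒜.AnalyticAt g (φ ⟨x, hU x.2⟩)

/-- `(M, S)` is an analytic manifold (with boundary and corners) of dimension `n`, of the given
kind. -/
structure IsAnalyticManifold (𝒜 : Kind) (n : ℕ) (S : FunctionSheaf M) : Prop where
  t2 : T2Space M
  secondCountable : SecondCountableTopology M
  exists_chart : ∀ x : M, ∃ (V : Set M) (φ : V → Fin n → ℝ≥0), x ∈ V ∧ IsLocalChart 𝒜 n S V φ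

/-- The set of points `x` with `e_x = k`: exactly `k` of the coordinates of `x` vanish in a local
chart at `x` (the number does not depend on the chart). -/
def depthLocus (𝒜 : Kind) (n : ℕ) (S : FunctionSheaf M) (k : ℕ) : Set M :=
  {x | ∃ (V : Set M) (φ : V → Fin n → ℝ≥0) (hx : x ∈ V),
    IsLocalChart 𝒜 n S V φ ∧ Nat.card {i // φ ⟨x, hx⟩ i = 0} = k}

/-- The strata of codimension `k`: the connected components of `{e = k}`. -/
def strataOfCodim (𝒜 : Kind) (n : ℕ) (S : FunctionSheaf M) (k : ℕ) : Set (Set M) :=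
  {T | ∃ x ∈ depthLocus 𝒜 n S k, T = connectedComponentIn (depthLocus 𝒜 n S k) x}

/-- The boundary components: the closures of the strata of codimension one. -/
def boundaryComponents (𝒜 : Kind) (n : ℕ) (S : FunctionSheaf M) : Set (Set M) :=
  closure '' strataOfCodim 𝒜 n S 1

/-- `𝒢` is the enrichment of the standard analytic manifold `(M, 𝒪)`: around each point there is a
chart `φ` of `(M, 𝒪)` in whose domain the sections of `𝒢` are the functions `f` with
`f ∘ φ⁻¹` generalized analytic. (The sheaf obtained does not depend on the charts.) -/
def IsEnrichment (n : ℕ) (𝒪 𝒢 : FunctionSheaf M) : Prop :=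
  ∀ x : M, ∃ (V : Set M) (φ : V → Fin n → ℝ≥0), x ∈ V ∧
    IsLocalChart .standard n 𝒪 V φ ∧ IsLocalChart .generalized n 𝒢 V φ

/-- `𝒪` is a standardization of the generalized analytic manifold `(M, 𝒢)`. -/
structure IsStandardization (n : ℕ) (𝒢 𝒪 : FunctionSheaf M) : Prop where
  isSubsheaf : 𝒪.IsSubsheaf 𝒢
  isManifold : IsAnalyticManifold .standard n 𝒪
  isEnrichment : IsEnrichment n 𝒪 𝒢

end Manifolds

/-! ### Monomial generalized analytic manifolds -/

/-- A generalized analytic manifold of dimension `n` with finitely many boundary components, with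
at least one corner point, and whose boundary is a strong normal crossings divisor: all the
intersections of boundary components (the empty one, which is `M`, included) are connected or
empty. -/
structure StratifiedGManifold (n : ℕ) (M : Type*) [TopologicalSpace M] where
  sheaf : FunctionSheaf M
  isManifold : IsAnalyticManifold .generalized n sheaf
  finite_components : (boundaryComponents .generalized n sheaf).Finite
  exists_corner : (depthLocus .generalized n sheaf n).Nonempty
  strongNormalCrossings : ∀ J ⊆ boundaryComponents .generalized n sheaf, IsPreconnected (⋂₀ J)

namespace StratifiedGManifold

variable {n : ℕ} {M : Type*} [TopologicalSpace M] (X : StratifiedGManifold n M)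

/-- The set of the boundary components, which serves as its own index set `I`. -/
def components : Set (Set M) := boundaryComponents .generalized n X.sheaf

/-- The number `N` of boundary components. -/
noncomputable def numComponents : ℕ := X.components.ncard

/-- The set of corner points, i.e. of the points with `e = n`. -/
def corners : Set M := depthLocus .generalized n X.sheaf n

/-- The index set `I_p`: the boundary components through `p`. -/
def Idx (p : M) : Type _ := {E : Set M // E ∈ X.components ∧ p ∈ E}

noncomputable instance (p : M) : Fintype (X.Idx p) :=
  haveI : Finite (X.Idx p) := (X.finite_components.subset (fun _ h => h.1) :
    {E : Set M | E ∈ X.components ∧ p ∈ E}.Finite).to_subtype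
  Fintype.ofFinite _

/-- `V_p^⋆`: the union of the strata that have `p` in their closure. -/
def star (p : M) : Set M :=
  ⋃₀ {T | (∃ k, T ∈ strataOfCodim .generalized n X.sheaf k) ∧ p ∈ closure T}

/-- `u = (u_E)_{E ∈ I_p}` is an affine chart at `p` over `V_p^⋆` for the sheaf `S`: a chart of
`(M, S)` with domain `V_p^⋆` and image `ℝ₊^{I_p}`, sending `p` to `0`, whose coordinates are
labelled so that `E ∩ V_p^⋆ = {u_E = 0}`. -/
structure IsAffineChart (𝒜 : Kind) (S : FunctionSheaf M) (p : M)
    (u : X.star p → X.Idx p → ℝ≥0) : Prop where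
  isChart : IsLocalChart 𝒜 n S (X.star p) u
  surjective : Function.Surjective u
  map_center : ∃ hp : p ∈ X.star p, u ⟨p, hp⟩ = 0
  label : ∀ (x : X.star p) (E : X.Idx p), u x E = 0 ↔ (x : M) ∈ E.1

/-- `C` is the matrix of exponents of a purely monomial change of coordinates from `u_p` to
`u_q`. (On `V_p^⋆ ∩ V_q^⋆` only factors with exponent `0` or positive exponent can have base `0`.) -/
def IsExponentMatrix {p q : M} (u : X.star p → X.Idx p → ℝ≥0) (v : X.star q → X.Idx q → ℝ≥0)
    (C : X.Idx q → X.Idx p → ℝ) : Prop :=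
  ∀ (x : M) (hp : x ∈ X.star p) (hq : x ∈ X.star q) (i : X.Idx q),
    v ⟨x, hq⟩ i = ∏ j : X.Idx p, u ⟨x, hp⟩ j ^ C i j

/-- A family of coordinate systems over the sets `V_p^⋆`, one for each corner point `p`. -/
abbrev CoordFamily : Type _ := (p : X.corners) → X.star (p : M) → X.Idx (p : M) → ℝ≥0

/-- `b` is a monomial atlas of `(M, S)`. This is used for the sheaf of the generalized manifold
itself and for its standardizations; their stratifications coincide. -/
structure IsMonomialAtlas (𝒜 : Kind) (S : FunctionSheaf M) (b : X.CoordFamily) : Prop where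
  isAffineChart : ∀ p : X.corners, X.IsAffineChart 𝒜 S p (b p)
  cover : ∀ x : M, ∃ p : X.corners, x ∈ X.star (p : M)
  monomial : ∀ p q : X.corners, ∃ C, X.IsExponentMatrix (b p) (b q) C

end StratifiedGManifold

/-- A monomial generalized analytic manifold `(ℳ, 𝔞)`. -/
structure MonomialGManifold (n : ℕ) (M : Type*) [TopologicalSpace M] extends
    StratifiedGManifold n M where
  coord : toStratifiedGManifold.CoordFamily
  isMonomialAtlas : toStratifiedGManifold.IsMonomialAtlas .generalized sheaf coord

namespace MonomialGManifold

variable {n : ℕ} {M : Type*} [TopologicalSpace M] (X : MonomialGManifold n M)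

/-- The matrix of exponents `C^{pq}` of the change of coordinates `x_q ∘ x_p⁻¹` (it is unique). -/
noncomputable def exponentMatrix (p q : X.corners) : X.Idx (q : M) → X.Idx (p : M) → ℝ :=
  Classical.choose (X.isMonomialAtlas.monomial p q)

/-- The weight connexion function `γ^{pq}_E = C^{pq}_{EE}`, for `E` in `I_p ∩ I_q`. -/
noncomputable def weight (p q : X.corners) (E : Set M) (hE : E ∈ X.components)
    (hp : (p : M) ∈ E) (hq : (q : M) ∈ E) : ℝ :=
  X.exponentMatrix p q ⟨E, hE, hq⟩ ⟨E, hE, hp⟩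

/-- The coordinates `u` over `V_p^⋆` are `u_E = x_{p,E}^{α_E}` for all `E ∈ I_p`. -/
def HasExponents (p : X.corners) (u : X.star (p : M) → X.Idx (p : M) → ℝ≥0)
    (α : X.Idx (p : M) → Set.Ioi (0 : ℝ)) : Prop :=
  ∀ x E, u x E = X.coord p x E ^ (α E : ℝ)

/-- `u` is a local m-standardization at the corner point `p`. -/
structure IsLocalMStandardization (p : X.corners)
    (u : X.star (p : M) → X.Idx (p : M) → ℝ≥0) : Prop where
  isAffineChart : X.IsAffineChart .generalized X.sheaf p u
  exists_exponents : ∃ α, X.HasExponents p u α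

/-- The set of the m-standardizations `(𝒪, 𝔟)`. -/
def mStandardizations : Set (FunctionSheaf M × X.CoordFamily) :=
  {s | IsStandardization n X.sheaf s.1 ∧ X.IsMonomialAtlas .standard s.1 s.2 ∧
    ∀ p, X.IsLocalMStandardization p (s.2 p)}

/-- The set `ℰ(u)` of the m-standardizations extending the coordinates `u` over `V_p^⋆`. -/
def extensions (p : X.corners) (u : X.star (p : M) → X.Idx (p : M) → ℝ≥0) :
    Set (FunctionSheaf M × X.CoordFamily) :=
  {s | s ∈ X.mStandardizations ∧ s.2 p = u}

end MonomialGManifold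

end GenAnalytic

/-! An m-standardization is determined by its exponents: they give the coordinates
`x_{p,E}^{α_{p,E}}`, and a sheaf is determined by a monomial atlas (`IsMonomialAtlas.sheaf_eq`). The
problem is therefore to decide which exponents `α` occur.

Near a generic point of a component `E`, all coordinates except the one labelled `E` are bounded
away from `0`. Hence the diagonal exponent of a monomial change of charts from `p` to `q` is the
limit of `log x_{q,E} / log x_{p,E}` (`tendsto_log_div_log`). It follows that the weights are
multiplicative along triples of corners, equal to `1` on the diagonal, and positive.

Necessity of the weight relations: a standard analytic transition that vanishes on `E` is locally
bounded by a multiple of the coordinate of `E`, so its diagonal exponent is at least `1`. The same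
holds for the inverse change, and the two exponents have product `1`, so both are `1`
(`exponent_eq_one`). In the coordinates `x^α` this exponent is `γ^{pq}_E α_{q,E} / α_{p,E}`.

Sufficiency: the coordinates of `p` that vanish at a point of both stars belong to components
through both `p` and `q`. In such a column only the diagonal entry can be nonzero
(`IsExponentMatrix.eq_zero`), and the relations make it `1`. The other factors are real powers of
positive numbers, so the transitions are analytic (`hasAnalyticTransitions_rpowCoord`) and the
functions analytic in these coordinates form a standardization.

Since the weights form a cocycle, a solution of the relations amounts to one free positive number
per component, read at any corner of it. Fixing the chart at `p` fixes the `n` numbers of the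
components through `p`.

Two supporting facts need most of the analysis: generalized analyticity is stable under powers of
the variables (`IsGenAnalyticAt.comp_rpow`), and a point of codimension one has exactly one
vanishing coordinate in every chart (`IsLocalChart.exists_zero_iff_eq`). The second ties the strata
to the labels of the affine charts. -/

namespace GenAnalytic

/-! ### Generalized power series: comparison with analytic germs, and substitution in one variable.
-/

section SeriesLemmas

open Filter

variable {ι : Type*} [Fintype ι]

/-- The generalized monomial `v ^ μ`. -/
noncomputable def genMonomial (v : ι → ℝ) (μ : ι → ℝ≥0) : ℝ := ∏ i, v i ^ (μ i : ℝ)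

theorem genMonomial_pos {v : ι → ℝ} (hv : ∀ i, 0 < v i) (μ : ι → ℝ≥0) : 0 < genMonomial v μ :=
  Finset.prod_pos fun i _ => Real.rpow_pos_of_pos (hv i) _

/-- Valid for negative entries of `v` too, as needed for the differences `y i - a i`: the real power
satisfies `|x ^ t| ≤ |x| ^ t`. -/
theorem abs_genMonomial_le {v ρ : ι → ℝ} (hv : ∀ i, |v i| ≤ ρ i) (μ : ι → ℝ≥0) :
    |genMonomial v μ| ≤ genMonomial ρ μ := by
  unfold genMonomial
  rw [Finset.abs_prod]
  refine Finset.prod_le_prod (fun i _ => abs_nonneg _) fun i _ => ?_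
  exact (Real.abs_rpow_le_abs_rpow _ _).trans
    (Real.rpow_le_rpow (abs_nonneg _) (hv i) (μ i).2)

/-- The exponent of the monomial attached to a word in the variables. -/
noncomputable def wordExponent [DecidableEq ι] (w : Σ n, Fin n → ι) : ι → ℝ≥0 :=
  fun i => ((Finset.univ.filter fun j => w.2 j = i).card : ℝ≥0)

theorem genMonomial_wordExponent [DecidableEq ι] (v : ι → ℝ) (w : Σ n, Fin n → ι) :
    genMonomial v (wordExponent w) = ∏ j, v (w.2 j) := by
  unfold genMonomial wordExponent
  rw [← Finset.prod_fiberwise' Finset.univ w.2 v]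
  refine Finset.prod_congr rfl fun i _ => ?_
  simp

/-- The power series of an analytic function, expanded into words. -/
theorem hasSum_words [DecidableEq ι] {F : (ι → ℝ) → ℝ} {a : ι → ℝ} (hF : AnalyticAt ℝ F a) :
    ∃ c : (Σ n, Fin n → ι) → ℝ, ∃ σ : ℝ, 0 < σ ∧
      (Summable fun w => |c w| * genMonomial (fun _ => σ) (wordExponent w)) ∧
      ∀ v : ι → ℝ, (∀ i, |v i| ≤ σ) →
        HasSum (fun w => c w * genMonomial v (wordExponent w)) (F (a + v)) := by
  obtain ⟨p, r, hp⟩ := hF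
  obtain ⟨r', hr'0, hr'⟩ := ENNReal.lt_iff_exists_nnreal_btwn.1 hp.r_pos
  have hr'0 : 0 < r' := by exact_mod_cast hr'0
  -- There are `(card ι) ^ n` words of length `n`, so absolute convergence over words uses `card ι *
  -- σ ≤ r'`; the bound `σ ≤ r'` keeps `v` in the ball of convergence.
  obtain ⟨σ, hσ0, hσr, hσc⟩ : ∃ σ : ℝ, 0 < σ ∧ σ ≤ r' ∧ Fintype.card ι * σ ≤ r' := by
    refine ⟨r' / (Fintype.card ι + 1), by positivity, ?_, ?_⟩
    · exact div_le_self r'.2 (by simp)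
    · rw [mul_div_assoc', div_le_iff₀ (by positivity)]
      nlinarith [r'.2, Nat.cast_nonneg (α := ℝ) (Fintype.card ι)]
  have hsum : Summable fun w : (Σ n, Fin n → ι) =>
      |p w.1 fun j => Pi.single (w.2 j) (1 : ℝ)| * genMonomial (fun _ => σ) (wordExponent w) := by
    have hb : ∀ n, ∑ f : Fin n → ι, |p n fun j => Pi.single (f j) (1 : ℝ)| * σ ^ n
        ≤ ‖p n‖ * (r' : ℝ) ^ n := by
      intro n
      have h1 : ∀ f : Fin n → ι, |p n fun j => Pi.single (f j) (1 : ℝ)| ≤ ‖p n‖ := by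
        intro f
        have := (p n).le_opNorm fun j => Pi.single (f j) (1 : ℝ)
        simpa [Pi.norm_single] using this
      calc _ ≤ ∑ f : Fin n → ι, ‖p n‖ * σ ^ n := by
            gcongr with f _; exact h1 f
        _ = ‖p n‖ * (Fintype.card ι * σ) ^ n := by
            simp [mul_pow]; ring
        _ ≤ _ := by gcongr
    have hs := p.summable_norm_mul_pow (hr'.trans_le hp.r_le)
    refine (summable_sigma_of_nonneg fun w => mul_nonneg (abs_nonneg _)
      (genMonomial_pos (fun _ => hσ0) _).le).2 ⟨fun n => Summable.of_finite, ?_⟩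
    refine Summable.of_nonneg_of_le (fun n => tsum_nonneg fun f => mul_nonneg (abs_nonneg _)
      (genMonomial_pos (fun _ => hσ0) _).le) (fun n => ?_) hs
    rw [tsum_fintype]
    simpa [genMonomial_wordExponent] using hb n
  refine ⟨_, σ, hσ0, hsum, fun v hv => ?_⟩
  have hv' : v ∈ Metric.eball (0 : ι → ℝ) r := by
    rw [Metric.mem_eball, edist_zero_right]
    refine lt_of_le_of_lt ?_ hr'
    rw [← ofReal_norm, ← ENNReal.ofReal_coe_nnreal]
    refine ENNReal.ofReal_le_ofReal ?_
    exact (pi_norm_le_iff_of_nonneg r'.2).2 fun i => (hv i).trans hσr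
  refine HasSum.sigma_of_hasSum (hp.hasSum hv') (fun n => ?_) ?_
  · have hve : (fun _ : Fin n => v) = fun _ => ∑ i, v i • (Pi.single i (1 : ℝ) : ι → ℝ) := by
      funext _
      ext k
      simp [Pi.single_apply]
    rw [hve, (p n).map_sum]
    convert hasSum_fintype _ with f
    rw [(p n).map_smul_univ, genMonomial_wordExponent]
    simp [mul_comm]
  · refine Summable.of_norm_bounded hsum fun w => ?_
    rw [norm_mul]
    exact mul_le_mul_of_nonneg_left (abs_genMonomial_le (by simpa using hv) _) (norm_nonneg _)

theorem isWF_range_natCast : (Set.range ((↑) : ℕ → ℝ≥0)).IsWF := by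
  rw [Set.isWF_iff_no_descending_seq]
  intro f hf hr
  choose k hk using hr
  have : StrictAnti k := fun a b hab => by
    have := hf hab
    rw [← hk, ← hk] at this
    exact_mod_cast this
  exact not_strictAnti_of_wellFoundedLT k this

/-- The words with a given exponent `μ` are grouped: the coefficient of the monomial `μ` is the sum
of theirs. The resulting exponents are natural numbers, so the support and mixedness conditions are
automatic. -/
theorem IsStdAnalyticAt.isGenAnalyticAt {g : (ι → ℝ≥0) → ℝ} {a : ι → ℝ≥0}
    (hg : IsStdAnalyticAt g a) : IsGenAnalyticAt g a := by
  classical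
  obtain ⟨F, hF, hgF⟩ := hg
  obtain ⟨c, σ, hσ0, hsum, hc⟩ := hasSum_words hF
  let e := Equiv.sigmaFiberEquiv (wordExponent (ι := ι))
  have hmon := genMonomial_pos (ι := ι) (v := fun _ => σ) (fun _ => hσ0)
  have hsum' : Summable fun w : (Σ μ, {w // wordExponent (ι := ι) w = μ}) =>
      |c w.2| * genMonomial (fun _ => σ) w.1 := by
    convert e.summable_iff.2 hsum with w
    obtain ⟨μ, w, rfl⟩ := w
    rfl
  have hfib : ∀ μ, Summable fun w : {w // wordExponent (ι := ι) w = μ} => |c w| := fun μ => by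
    have := (hsum'.sigma_factor μ).mul_right (genMonomial (fun _ => σ) μ)⁻¹
    simpa [mul_assoc, (hmon μ).ne'] using this
  have hsupp : ∀ μ : ι → ℝ≥0, (∑' w : {w // wordExponent (ι := ι) w = μ}, c w) ≠ 0 →
      ∀ i, ∃ k : ℕ, μ i = k := by
    intro μ hμ i
    have : Nonempty {w // wordExponent (ι := ι) w = μ} := by
      by_contra h
      rw [not_nonempty_iff] at h
      exact hμ tsum_empty
    obtain ⟨w, rfl⟩ := this
    exact ⟨_, rfl⟩
  refine ⟨fun μ => ∑' w : {w // wordExponent (ι := ι) w = μ}, c w,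
    ⟨fun _ => Set.range ((↑) : ℕ → ℝ≥0), fun _ => isWF_range_natCast, ?_⟩,
    ⟨fun _ => σ, fun _ => hσ0, ?_⟩, ?_, ?_⟩
  · intro μ hμ i _
    obtain ⟨k, hk⟩ := hsupp μ hμ i
    exact ⟨k, hk.symm⟩
  · refine Summable.of_nonneg_of_le (fun μ => mul_nonneg (abs_nonneg _) (hmon μ).le) (fun μ => ?_)
      hsum'.sigma
    change _ ≤ ∑' w : {w // wordExponent (ι := ι) w = μ}, |c w| * genMonomial (fun _ => σ) μ
    rw [tsum_mul_right]
    refine mul_le_mul_of_nonneg_right ?_ (hmon μ).le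
    exact norm_tsum_le_tsum_norm (f := fun w : {w // wordExponent (ι := ι) w = μ} => c w) (hfib μ)
  · exact fun μ hμ i _ => hsupp μ hμ i
  · have hball : ∀ᶠ y : ι → ℝ≥0 in 𝓝 a, ∀ i, |(y i : ℝ) - a i| ≤ σ := by
      rw [eventually_all]
      intro i
      have : Tendsto (fun y : ι → ℝ≥0 => |(y i : ℝ) - a i|) (𝓝 a) (𝓝 |(a i : ℝ) - a i|) :=
        Continuous.tendsto (by fun_prop) a
      rw [sub_self, abs_zero] at this
      exact (this.eventually_lt_const hσ0).mono fun _ h => h.le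
    filter_upwards [hgF, hball] with y hy hyb
    have h := hc (fun i => (y i : ℝ) - a i) hyb
    have hy' : ((fun i => (a i : ℝ)) + fun i => (y i : ℝ) - a i) = fun i => (y i : ℝ) := by
      ext i; simp
    rw [hy', ← hy, ← e.hasSum_iff] at h
    refine h.sigma fun μ => ?_
    have h1 := (hfib μ).of_abs.hasSum.mul_right (genMonomial (fun i => (y i : ℝ) - a i) μ)
    refine h1.congr_fun ?_
    rintro ⟨w, rfl⟩
    rfl

/-- The monomial of exponent `k` as a multilinear map, if its degree is `n`. -/
noncomputable def monomialMultilinear (n : ℕ) (k : ι → ℕ) :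
    ContinuousMultilinearMap ℝ (fun _ : Fin n => ι → ℝ) ℝ :=
  if h : Fintype.card (Σ i, Fin (k i)) = n then
    (ContinuousMultilinearMap.mkPiAlgebra ℝ (Fin n) ℝ).compContinuousLinearMap
      fun j => ContinuousLinearMap.proj ((Fintype.equivFinOfCardEq h).symm j).1
  else 0

theorem monomialMultilinear_apply {n : ℕ} {k : ι → ℕ} (h : ∑ i, k i = n) (v : ι → ℝ) :
    monomialMultilinear n k (fun _ => v) = ∏ i, v i ^ k i := by
  have h' : Fintype.card (Σ i, Fin (k i)) = n := by simpa using h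
  rw [monomialMultilinear, dif_pos h']
  simp only [ContinuousMultilinearMap.compContinuousLinearMap_apply,
    ContinuousMultilinearMap.mkPiAlgebra_apply, ContinuousLinearMap.proj_apply]
  rw [Equiv.prod_comp (Fintype.equivFinOfCardEq h').symm (fun x : (Σ i, Fin (k i)) => v x.1),
    Fintype.prod_sigma]
  simp

theorem norm_monomialMultilinear_le (n : ℕ) (k : ι → ℕ) : ‖monomialMultilinear n k‖ ≤ 1 := by
  rw [monomialMultilinear]
  split_ifs with h
  · refine ContinuousMultilinearMap.opNorm_le_bound zero_le_one fun m => ?_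
    simp only [ContinuousMultilinearMap.compContinuousLinearMap_apply,
      ContinuousMultilinearMap.mkPiAlgebra_apply, ContinuousLinearMap.proj_apply, one_mul,
      norm_prod]
    exact Finset.prod_le_prod (fun _ _ => norm_nonneg _) fun j _ => norm_le_pi_norm _ _
  · simp

theorem hasSum_subtype_of_mem_iff {β : Type*} {P : β → Prop} {s : Finset β}
    (h : ∀ b, b ∈ s ↔ P b) (f : β → ℝ) : HasSum (fun b : {b // P b} => f b) (∑ b ∈ s, f b) := by
  obtain rfl : (· ∈ s) = P := funext fun b => propext (h b)
  exact s.hasSum f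

/-- An absolutely convergent power series in several variables is analytic. -/
theorem analyticAt_of_hasSum {c : (ι → ℕ) → ℝ} {ρ : ℝ} (hρ : 0 < ρ)
    (hc : Summable fun k => |c k| * ∏ i, ρ ^ k i) (a : ι → ℝ) :
    AnalyticAt ℝ (fun z : ι → ℝ => ∑' k, c k * ∏ i, (z i - a i) ^ k i) a := by
  classical
  lift ρ to ℝ≥0 using hρ.le
  let p : FormalMultilinearSeries ℝ (ι → ℝ) ℝ := fun n =>
    ∑ k ∈ Finset.piAntidiag Finset.univ n, c k • monomialMultilinear n k
  have hrad : (ρ : ENNReal) ≤ p.radius := by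
    refine p.le_radius_of_bound (∑' k, |c k| * ∏ i, (ρ : ℝ) ^ k i) fun n => ?_
    refine le_trans ?_ (hc.sum_le_tsum (Finset.piAntidiag Finset.univ n) fun k _ => by positivity)
    calc ‖p n‖ * (ρ : ℝ) ^ n
        ≤ (∑ k ∈ Finset.piAntidiag Finset.univ n, |c k|) * (ρ : ℝ) ^ n := by
          gcongr
          refine norm_sum_le_of_le _ fun k _ => ?_
          rw [norm_smul]
          exact mul_le_of_le_one_right (norm_nonneg _) (norm_monomialMultilinear_le n k)
      _ = _ := by
          rw [Finset.sum_mul]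
          refine Finset.sum_congr rfl fun k hk => ?_
          rw [Finset.prod_pow_eq_pow_sum, (Finset.mem_piAntidiag.1 hk).1]
  refine ⟨p, ρ, hrad, by simpa using hρ, fun {v} hv => ?_⟩
  have hv' : ∀ i, |v i| ≤ ρ := by
    intro i
    rw [Metric.mem_eball, edist_zero_right] at hv
    have : ‖v‖ ≤ ρ := by
      have := hv.le
      rw [← ofReal_norm, ← ENNReal.ofReal_coe_nnreal] at this
      exact (ENNReal.ofReal_le_ofReal_iff ρ.2).1 this
    exact (norm_le_pi_norm v i).trans this
  have hs : Summable fun k : ι → ℕ => c k * ∏ i, v i ^ k i := by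
    refine Summable.of_norm_bounded hc fun k => ?_
    rw [norm_mul, norm_prod]
    simp only [norm_pow, Real.norm_eq_abs]
    gcongr with i _
    exact hv' i
  have h := hs.hasSum
  rw [← (Equiv.sigmaFiberEquiv fun k : ι → ℕ => ∑ i, k i).hasSum_iff] at h
  simp only [Pi.add_apply, add_sub_cancel_left]
  refine h.sigma fun n => ?_
  have hval : (p n fun _ => v) =
      ∑ k ∈ Finset.piAntidiag Finset.univ n, c k * ∏ i, v i ^ k i := by
    simp only [p, sum_apply, smul_apply, smul_eq_mul]
    refine Finset.sum_congr rfl fun k hk => ?_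
    rw [monomialMultilinear_apply (Finset.mem_piAntidiag.1 hk).1]
  rw [hval]
  exact hasSum_subtype_of_mem_iff (P := fun k : ι → ℕ => ∑ i, k i = n) (by simp)
    fun k : ι → ℕ => c k * ∏ i, v i ^ k i

/-- On the intersection of the coordinate hyperplanes through `a`, a generalized analytic function
is analytic near `a`. -/
theorem IsGenAnalyticAt.exists_analyticAt {g : (ι → ℝ≥0) → ℝ} {a : ι → ℝ≥0}
    (hg : IsGenAnalyticAt g a) :
    ∃ F : (ι → ℝ) → ℝ, AnalyticAt ℝ F (fun i => (a i : ℝ)) ∧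
      ∀ᶠ y in 𝓝 a, (∀ i, a i = 0 → y i = 0) → g y = F (fun i => (y i : ℝ)) := by
  classical
  obtain ⟨s, -, ⟨ρ, hρ, hs⟩, hmix, hsum⟩ := hg
  obtain ⟨r, hr, hrρ⟩ : ∃ r : ℝ, 0 < r ∧ ∀ i, r ≤ ρ i := by
    have h : ∀ᶠ r : ℝ in 𝓝[>] 0, 0 < r ∧ ∀ i, r ≤ ρ i :=
      eventually_mem_nhdsWithin.and <| eventually_all.2 fun i =>
        ((eventually_lt_nhds (hρ i)).filter_mono nhdsWithin_le_nhds).mono fun _ h => h.le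
    exact h.exists
  let em : (ι → ℕ) → ι → ℝ≥0 := fun k i => (k i : ℝ≥0)
  have hem : Function.Injective em := fun k l h => by
    ext i
    have := congrFun h i
    simpa [em] using this
  -- On the face where the coordinates vanishing at `a` stay zero, a monomial survives only if its
  -- exponents in those variables are `0`. The remaining exponents are natural because the series is
  -- mixed.
  let c : (ι → ℕ) → ℝ := fun k => if ∀ i, a i = 0 → k i = 0 then s (em k) else 0
  have hc : Summable fun k => |c k| * ∏ i, r ^ k i := by
    refine Summable.of_nonneg_of_le (fun k => by positivity) (fun k => ?_)
      (hs.comp_injective hem)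
    simp only [Function.comp, c, em]
    split_ifs with h
    · refine mul_le_mul_of_nonneg_left ?_ (abs_nonneg _)
      refine Finset.prod_le_prod (fun i _ => by positivity) fun i _ => ?_
      simp only [NNReal.coe_natCast, Real.rpow_natCast]
      exact pow_le_pow_left₀ hr.le (hrρ i) _
    · rw [abs_zero, zero_mul]
      exact mul_nonneg (abs_nonneg _)
        (Finset.prod_nonneg fun i _ => Real.rpow_nonneg (hρ i).le _)
  refine ⟨_, analyticAt_of_hasSum hr hc _, ?_⟩
  filter_upwards [hsum] with y hy hy0
  refine (HasSum.tsum_eq ?_).symm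
  rw [← hem.hasSum_iff] at hy
  · refine hy.congr_fun fun k => ?_
    simp only [Function.comp, c, em]
    split_ifs with h
    · simp
    · push Not at h
      obtain ⟨i, hi, hki⟩ := h
      rw [zero_mul, Finset.prod_eq_zero (Finset.mem_univ i), mul_zero]
      simp [hi, hy0 i hi, hki]
  · intro μ hμ
    by_cases hsμ : s μ = 0
    · simp [hsμ]
    by_cases h : ∀ i, a i = 0 → μ i = 0
    · refine absurd ?_ hμ
      have : ∀ i, ∃ k : ℕ, μ i = k := fun i => by
        by_cases hi : a i = 0
        · exact ⟨0, by simp [h i hi]⟩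
        · exact hmix μ hsμ i hi
      choose k hk using this
      exact ⟨k, funext fun i => (hk i).symm⟩
    · push Not at h
      obtain ⟨i, hi, hki⟩ := h
      rw [Finset.prod_eq_zero (Finset.mem_univ i), mul_zero]
      rw [hi, hy0 i hi, sub_self, Real.zero_rpow (by simpa using hki)]

theorem genMonomial_update [DecidableEq ι] (v : ι → ℝ) (μ : ι → ℝ≥0) (i : ι) (τ : ℝ≥0) :
    genMonomial v (Function.update μ i τ) =
      (∏ j ∈ Finset.univ.erase i, v j ^ (μ j : ℝ)) * v i ^ (τ : ℝ) := by
  unfold genMonomial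
  rw [← Finset.prod_erase_mul _ _ (Finset.mem_univ i), Function.update_self]
  congr 1
  refine Finset.prod_congr rfl fun j hj => ?_
  rw [Function.update_of_ne (Finset.ne_of_mem_erase hj)]

theorem genMonomial_eq [DecidableEq ι] (v : ι → ℝ) (μ : ι → ℝ≥0) (i : ι) :
    genMonomial v μ = (∏ j ∈ Finset.univ.erase i, v j ^ (μ j : ℝ)) * v i ^ (μ i : ℝ) := by
  rw [← genMonomial_update, Function.update_eq_self]

/-- Exchange of the exponent of the variable `i` with an additional exponent. -/
def swapExponent [DecidableEq ι] (i : ι) : (ι → ℝ≥0) × ℝ≥0 ≃ (ι → ℝ≥0) × ℝ≥0 where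
  toFun x := (Function.update x.1 i x.2, x.1 i)
  invFun x := (Function.update x.1 i x.2, x.1 i)
  left_inv x := by simp
  right_inv x := by simp

/-- Substitution `y i = θ (w i)` in one variable; the powers of `θ w - a i` are given by the
series with coefficients `e κ τ`. -/
theorem IsGenAnalyticAt.comp_update [DecidableEq ι] {g : (ι → ℝ≥0) → ℝ} {a : ι → ℝ≥0}
    (hg : IsGenAnalyticAt g a) (i : ι) {b : ℝ≥0} {θ : ℝ≥0 → ℝ≥0} {K : Set ℝ≥0}
    {e : ℝ≥0 → ℝ≥0 → ℝ} (hθ : Tendsto θ (𝓝 b) (𝓝 (a i)))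
    (hK : ∀ κ : ℝ≥0, (a i ≠ 0 → ∃ k : ℕ, κ = k) → κ ∈ K)
    (hbound : ∀ ρ : ℝ, 0 < ρ → ∃ σ : ℝ, 0 < σ ∧ ∀ κ ∈ K,
      (Summable fun τ : ℝ≥0 => |e κ τ| * σ ^ (τ : ℝ)) ∧
        ∑' τ : ℝ≥0, |e κ τ| * σ ^ (τ : ℝ) ≤ ρ ^ (κ : ℝ))
    (hexp : ∀ᶠ w : ℝ≥0 in 𝓝 b, ∀ κ ∈ K,
      HasSum (fun τ : ℝ≥0 => e κ τ * ((w : ℝ) - b) ^ (τ : ℝ)) (((θ w : ℝ) - a i) ^ (κ : ℝ)))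
    (hmix' : b ≠ 0 → ∀ κ ∈ K, ∀ τ, e κ τ ≠ 0 → ∃ k : ℕ, τ = k)
    (hwf : ∀ W : Set ℝ≥0, W.IsWF → {τ | ∃ κ ∈ W, κ ∈ K ∧ e κ τ ≠ 0}.IsWF) :
    IsGenAnalyticAt (fun w => g (Function.update w i (θ (w i)))) (Function.update a i b) := by
  obtain ⟨s, ⟨W, hW, hsW⟩, ⟨ρ, hρ, hs⟩, hmix, hsum⟩ := hg
  obtain ⟨σ, hσ, hbound⟩ := hbound (ρ i) (hρ i)
  have hsK : ∀ μ, s μ ≠ 0 → μ i ∈ K := fun μ hμ => hK _ (hmix μ hμ i)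
  set ρ' : ι → ℝ := Function.update ρ i σ with hρ'def
  have hρ' : ∀ j, 0 < ρ' j := fun j => by
    by_cases h : j = i
    · subst h; simpa [ρ'] using hσ
    · simpa [ρ', h] using hρ j
  have hρ'j : ∀ j ∈ Finset.univ.erase i, ρ' j = ρ j := fun j hj => by
    simp [ρ', Finset.ne_of_mem_erase hj]
  let T : (ι → ℝ) → (ι → ℝ≥0) × ℝ≥0 → ℝ := fun v x =>
    s x.1 * e (x.1 i) x.2 * genMonomial v (Function.update x.1 i x.2)
  have hT : ∀ v x, T v x = s x.1 * (∏ j ∈ Finset.univ.erase i, v j ^ (x.1 j : ℝ)) *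
      (e (x.1 i) x.2 * v i ^ (x.2 : ℝ)) := fun v x => by
    simp only [T, genMonomial_update]; ring
  let A : (ι → ℝ≥0) × ℝ≥0 → ℝ := fun x =>
    |s x.1 * e (x.1 i) x.2| * genMonomial ρ' (Function.update x.1 i x.2)
  have hA0 : ∀ x, 0 ≤ A x := fun x => mul_nonneg (abs_nonneg _) (genMonomial_pos hρ' _).le
  have hA : ∀ x, A x = |s x.1| * (∏ j ∈ Finset.univ.erase i, ρ j ^ (x.1 j : ℝ)) *
      (|e (x.1 i) x.2| * σ ^ (x.2 : ℝ)) := fun x => by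
    simp only [A, genMonomial_update, abs_mul]
    rw [Finset.prod_congr rfl fun j hj => by rw [hρ'j j hj]]
    simp only [ρ', Function.update_self]; ring
  have hAs : Summable A := by
    refine (summable_prod_of_nonneg hA0).2 ⟨fun μ => ?_, ?_⟩
    · by_cases hμ : s μ = 0
      · simp [A, hμ]
      · simp only [hA]
        exact (hbound _ (hsK μ hμ)).1.mul_left _
    · refine Summable.of_nonneg_of_le (fun μ => tsum_nonneg fun τ => hA0 _) (fun μ => ?_) hs
      by_cases hμ : s μ = 0
      · simp [A, hμ]
      · simp only [hA]
        rw [tsum_mul_left]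
        change _ ≤ |s μ| * genMonomial ρ μ
        rw [genMonomial_eq ρ μ i, ← mul_assoc]
        refine mul_le_mul_of_nonneg_left (hbound _ (hsK μ hμ)).2 ?_
        exact mul_nonneg (abs_nonneg _)
          (Finset.prod_nonneg fun j _ => Real.rpow_nonneg (hρ j).le _)
  -- The double family is indexed by an old exponent `μ` and a new exponent `τ` of variable `i`.
  -- Regrouped by the new exponent vector `ν`, it leaves a sum over the old exponent `κ` of variable
  -- `i`.
  let s' : (ι → ℝ≥0) → ℝ := fun ν => ∑' κ, s (Function.update ν i κ) * e κ (ν i)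
  have hA's : Summable fun x : (ι → ℝ≥0) × ℝ≥0 =>
      |s (Function.update x.1 i x.2) * e x.2 (x.1 i)| * genMonomial ρ' x.1 := by
    refine ((swapExponent i).summable_iff.2 hAs).congr fun x => ?_
    simp [A, swapExponent]
  have hfib : ∀ ν : ι → ℝ≥0, Summable fun κ => |s (Function.update ν i κ) * e κ (ν i)| :=
    fun ν => by
    have := (hA's.prod_factor ν).mul_right (genMonomial ρ' ν)⁻¹
    refine this.congr fun κ => ?_
    rw [mul_assoc, mul_inv_cancel₀ (genMonomial_pos hρ' ν).ne', mul_one]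
  have hs'0 : ∀ ν, s' ν ≠ 0 → ∃ κ, s (Function.update ν i κ) ≠ 0 ∧ e κ (ν i) ≠ 0 := by
    intro ν hν
    by_contra! h
    refine hν ?_
    have : ∀ κ, s (Function.update ν i κ) * e κ (ν i) = 0 := fun κ => by
      by_cases h0 : s (Function.update ν i κ) = 0
      · rw [h0, zero_mul]
      · rw [h κ h0, mul_zero]
    simp [s', this]
  refine ⟨s', ⟨Function.update W i {τ | ∃ κ ∈ W i, κ ∈ K ∧ e κ τ ≠ 0}, ?_, ?_⟩,
    ⟨ρ', hρ', ?_⟩, ?_, ?_⟩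
  · intro j
    by_cases h : j = i
    · subst h; simpa using hwf _ (hW j)
    · simpa [h] using hW j
  · intro ν hν j _
    obtain ⟨κ, hκ, hκe⟩ := hs'0 ν hν
    have h1 := hsW hκ
    by_cases h : j = i
    · subst h
      simp only [Function.update_self]
      refine ⟨κ, by simpa using h1 j trivial, by simpa using hsK _ hκ, hκe⟩
    · simpa [h] using h1 j trivial
  · refine Summable.of_nonneg_of_le
      (fun ν => mul_nonneg (abs_nonneg _) (genMonomial_pos hρ' ν).le) (fun ν => ?_) hA's.prod
    change |s' ν| * genMonomial ρ' ν ≤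
      ∑' κ, |s (Function.update ν i κ) * e κ (ν i)| * genMonomial ρ' ν
    rw [tsum_mul_right]
    refine mul_le_mul_of_nonneg_right ?_ (genMonomial_pos hρ' ν).le
    exact norm_tsum_le_tsum_norm (f := fun κ => s (Function.update ν i κ) * e κ (ν i)) (hfib ν)
  · intro ν hν j hj
    obtain ⟨κ, hκ, hκe⟩ := hs'0 ν hν
    by_cases h : j = i
    · subst h
      exact hmix' (by simpa using hj) κ (by simpa using hsK _ hκ) _ hκe
    · have := hmix _ hκ j (by simpa [h] using hj)
      simpa [h] using this
  · have hball : ∀ᶠ w : ι → ℝ≥0 in 𝓝 (Function.update a i b),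
        ∀ j, |(w j : ℝ) - (Function.update a i b j : ℝ≥0)| ≤ ρ' j := by
      rw [eventually_all]
      intro j
      have : Tendsto (fun w : ι → ℝ≥0 => |(w j : ℝ) - (Function.update a i b j : ℝ≥0)|)
          (𝓝 (Function.update a i b))
          (𝓝 |((Function.update a i b j : ℝ≥0) : ℝ) - (Function.update a i b j : ℝ≥0)|) :=
        Continuous.tendsto (by fun_prop) _
      rw [sub_self, abs_zero] at this
      exact (this.eventually_lt_const (hρ' j)).mono fun _ h => h.le
    have hi : Tendsto (fun w : ι → ℝ≥0 => w i) (𝓝 (Function.update a i b)) (𝓝 b) := by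
      have := (continuous_apply (A := fun _ : ι => ℝ≥0) i).tendsto (Function.update a i b)
      simpa using this
    have hupd : Tendsto (fun w : ι → ℝ≥0 => Function.update w i (θ (w i)))
        (𝓝 (Function.update a i b)) (𝓝 a) := by
      have h := (tendsto_id (x := 𝓝 (Function.update a i b))).update i (hθ.comp hi)
      simpa using h
    filter_upwards [hball, hi.eventually hexp, hupd.eventually hsum] with w hw hwe hws
    set v : ι → ℝ := fun j => (w j : ℝ) - (Function.update a i b j : ℝ≥0) with hv
    have hTs : Summable (T v) := by
      refine Summable.of_norm_bounded hAs fun x => ?_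
      rw [norm_mul]
      exact mul_le_mul_of_nonneg_left (abs_genMonomial_le hw _) (norm_nonneg _)
    have hvi : v i = (w i : ℝ) - b := by simp [v]
    have hvj : ∀ j ∈ Finset.univ.erase i,
        v j = (Function.update w i (θ (w i)) j : ℝ) - (a j : ℝ) := fun j hj => by
      simp [v, Finset.ne_of_mem_erase hj]
    have h1 : HasSum (T v) (g (Function.update w i (θ (w i)))) := by
      have h2 := hTs.hasSum.prod_fiberwise
        (g := fun μ => s μ * genMonomial
          (fun j => (Function.update w i (θ (w i)) j : ℝ) - (a j : ℝ)) μ) fun μ => by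
        by_cases hμ : s μ = 0
        · simp [T, hμ]
        · simp only [hT]
          rw [genMonomial_eq _ μ i, ← mul_assoc, Function.update_self, hvi,
            Finset.prod_congr rfl fun j hj => by rw [hvj j hj]]
          exact (hwe _ (hsK μ hμ)).mul_left _
      have := h2.unique hws
      rw [← this]
      exact hTs.hasSum
    rw [← (swapExponent i).hasSum_iff] at h1
    refine h1.prod_fiberwise fun ν => ?_
    refine ((hfib ν).of_abs.hasSum.mul_right (genMonomial v ν)).congr_fun fun κ => ?_
    simp [T, swapExponent]

end SeriesLemmas

/-! ### Powers of the variables preserve generalized analyticity. -/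

section PowerSubstitution

open Filter

/-- The weighted `ℓ¹` norm of radius `σ` is submultiplicative for the Cauchy product. The same `σ`
serves all powers, a uniformity required by the substitution lemma. -/
theorem summable_coeff_pow (f : PowerSeries ℝ) {σ ρ : ℝ} (hσ : 0 ≤ σ)
    (hf : Summable fun m => |PowerSeries.coeff m f| * σ ^ m)
    (hρ : ∑' m, |PowerSeries.coeff m f| * σ ^ m ≤ ρ) (k : ℕ) :
    (Summable fun m => |PowerSeries.coeff m (f ^ k)| * σ ^ m) ∧
      ∑' m, |PowerSeries.coeff m (f ^ k)| * σ ^ m ≤ ρ ^ k := by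
  have hρ0 : 0 ≤ ρ := le_trans (tsum_nonneg fun m => by positivity) hρ
  induction k with
  | zero =>
    have h : HasSum (fun m => |PowerSeries.coeff m (f ^ 0)| * σ ^ m) 1 := by
      convert hasSum_single (f := fun m => |PowerSeries.coeff m (f ^ 0)| * σ ^ m) 0 ?_ using 1
      · simp
      · intro m hm
        simp [PowerSeries.coeff_one, hm]
    exact ⟨h.summable, by rw [h.tsum_eq, pow_zero]⟩
  | succ k ih =>
    have hle : ∀ m, |PowerSeries.coeff m (f ^ (k + 1))| * σ ^ m ≤
        ∑ x ∈ Finset.HasAntidiagonal.antidiagonal m, (|PowerSeries.coeff x.1 (f ^ k)| * σ ^ x.1) *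
          (|PowerSeries.coeff x.2 f| * σ ^ x.2) := by
      intro m
      rw [pow_succ, PowerSeries.coeff_mul]
      refine (mul_le_mul_of_nonneg_right (Finset.abs_sum_le_sum_abs _ _) (by positivity)).trans ?_
      rw [Finset.sum_mul]
      refine Finset.sum_le_sum fun x hx => le_of_eq ?_
      rw [← Finset.HasAntidiagonal.mem_antidiagonal.1 hx, pow_add, abs_mul]
      ring
    have h1 := ih.1.norm
    have h2 := hf.norm
    have hs := (summable_norm_sum_mul_antidiagonal_of_summable_norm h1 h2).of_norm
    have heq := tsum_mul_tsum_eq_tsum_sum_antidiagonal_of_summable_norm h1 h2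
    have hsum := Summable.of_nonneg_of_le (fun m => by positivity) hle hs
    refine ⟨hsum, (hsum.tsum_le_tsum hle hs).trans ?_⟩
    rw [← heq, pow_succ]
    exact mul_le_mul ih.2 hρ (tsum_nonneg fun m => by positivity) (by positivity)

theorem hasSum_coeff_pow (f : PowerSeries ℝ) {σ t y : ℝ} (ht : |t| ≤ σ)
    (hf : Summable fun m => |PowerSeries.coeff m f| * σ ^ m)
    (hy : HasSum (fun m => PowerSeries.coeff m f * t ^ m) y) (k : ℕ) :
    HasSum (fun m => PowerSeries.coeff m (f ^ k) * t ^ m) (y ^ k) := by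
  have hσ : 0 ≤ σ := (abs_nonneg t).trans ht
  have habs : ∀ k, Summable fun m => ‖PowerSeries.coeff m (f ^ k) * t ^ m‖ := fun k => by
    refine Summable.of_nonneg_of_le (fun m => norm_nonneg _) (fun m => ?_)
      (summable_coeff_pow f hσ hf le_rfl k).1
    rw [norm_mul, norm_pow]
    exact mul_le_mul_of_nonneg_left (pow_le_pow_left₀ (norm_nonneg _) ht m) (norm_nonneg _)
  induction k with
  | zero =>
    convert hasSum_single (f := fun m => PowerSeries.coeff m (f ^ 0) * t ^ m) 0 ?_ using 1
    · simp
    · intro m hm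
      simp [PowerSeries.coeff_one, hm]
  | succ k ih =>
    have h1 : Summable fun m => ‖PowerSeries.coeff m f * t ^ m‖ := by simpa using habs 1
    have heq := tsum_mul_tsum_eq_tsum_sum_antidiagonal_of_summable_norm (habs k) h1
    rw [ih.tsum_eq, hy.tsum_eq, ← pow_succ] at heq
    have h2 : Summable fun m => PowerSeries.coeff m (f ^ (k + 1)) * t ^ m := (habs (k + 1)).of_norm
    rw [heq, h2.hasSum_iff]
    refine tsum_congr fun m => ?_
    rw [pow_succ, PowerSeries.coeff_mul, Finset.sum_mul]
    refine Finset.sum_congr rfl fun x hx => ?_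
    rw [← Finset.HasAntidiagonal.mem_antidiagonal.1 hx, pow_add]
    ring

/-- Expansions of the powers of an analytic function that vanishes at `b`. -/
theorem exists_coeff_pow {F : ℝ → ℝ} {b : ℝ} (hF : AnalyticAt ℝ F b) (hb : F b = 0) :
    ∃ C : ℕ → ℕ → ℝ,
      (∀ ρ : ℝ, 0 < ρ → ∃ σ : ℝ, 0 < σ ∧ ∀ k, (Summable fun m => |C k m| * σ ^ m) ∧
        ∑' m, |C k m| * σ ^ m ≤ ρ ^ k) ∧
      ∀ᶠ w in 𝓝 b, ∀ k, HasSum (fun m => C k m * (w - b) ^ m) (F w ^ k) := by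
  obtain ⟨p, hp⟩ := hF
  have hp' := hasFPowerSeriesAt_iff'.1 hp
  obtain ⟨r, hr0, hr⟩ := ENNReal.lt_iff_exists_nnreal_btwn.1 hp.radius_pos
  have hr0 : (0 : ℝ) < r := by exact_mod_cast hr0
  obtain ⟨f, hf⟩ : ∃ f : PowerSeries ℝ, ∀ m, PowerSeries.coeff m f = p.coeff m :=
    ⟨PowerSeries.mk p.coeff, by simp⟩
  have hf0 : PowerSeries.coeff 0 f = 0 := by
    have := hp'.self_of_nhds
    simp only [sub_self, smul_eq_mul, hb] at this
    have h2 := hasSum_single (f := fun n => (0 : ℝ) ^ n * p.coeff n) 0 (fun n hn => by simp [hn])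
    simpa [hf] using h2.unique this
  have hfr : Summable fun m => |PowerSeries.coeff m f| * (r : ℝ) ^ m := by
    refine (p.summable_norm_mul_pow hr).congr fun m => ?_
    simp [hf, FormalMultilinearSeries.norm_apply_eq_norm_coef]
  have hfσ : ∀ σ : ℝ, 0 ≤ σ → σ ≤ r → Summable fun m => |PowerSeries.coeff m f| * σ ^ m :=
    fun σ h0 h1 => Summable.of_nonneg_of_le (fun m => by positivity)
      (fun m => by gcongr) hfr
  refine ⟨fun k m => PowerSeries.coeff m (f ^ k), fun ρ hρ => ?_, ?_⟩
  · set B := ∑' m, |PowerSeries.coeff m f| * (r : ℝ) ^ m with hB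
    have hB0 : 0 ≤ B := tsum_nonneg fun m => by positivity
    -- As `f` has no constant term, shrinking the radius by the factor `c ≤ 1` shrinks its norm at
    -- least by `c`.
    obtain ⟨c, hc0, hc1, hcB⟩ : ∃ c : ℝ, 0 < c ∧ c ≤ 1 ∧ c * B ≤ ρ := by
      refine ⟨min 1 (ρ / (B + 1)), by positivity, min_le_left _ _, ?_⟩
      calc _ ≤ ρ / (B + 1) * B := by gcongr; exact min_le_right _ _
        _ ≤ ρ := by rw [div_mul_eq_mul_div, div_le_iff₀ (by positivity)]; nlinarith
    have hcr : c * r ≤ r := mul_le_of_le_one_left hr0.le hc1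
    have hcr0 : 0 ≤ c * r := by positivity
    have hs := hfσ _ hcr0 hcr
    suffices h : ∑' m, |PowerSeries.coeff m f| * (c * r) ^ m ≤ ρ by
      have h2 := summable_coeff_pow f hcr0 hs h
      have h3 : 0 < c * r := by positivity
      exact ⟨c * r, h3, h2⟩
    refine le_trans ?_ hcB
    rw [hB, ← tsum_mul_left]
    refine (hfσ _ (by positivity) hcr).tsum_le_tsum (fun m => ?_) (hfr.mul_left c)
    cases m with
    | zero => rw [hf0]; simp
    | succ m =>
      rw [mul_pow, mul_left_comm]
      refine mul_le_mul_of_nonneg_right ?_ (by positivity)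
      rw [pow_succ]
      exact mul_le_of_le_one_left hc0.le (pow_le_one₀ hc0.le hc1)
  · have hball : ∀ᶠ w in 𝓝 b, |w - b| ≤ r := by
      have : Tendsto (fun w : ℝ => |w - b|) (𝓝 b) (𝓝 |b - b|) :=
        Continuous.tendsto (by fun_prop) b
      rw [sub_self, abs_zero] at this
      exact (this.eventually_lt_const hr0).mono fun _ h => h.le
    filter_upwards [hp', hball] with w hw hwb k
    refine hasSum_coeff_pow f hwb hfr ?_ k
    refine hw.congr_fun fun m => ?_
    simp [hf, mul_comm]

theorem analyticAt_rpow_const {x : ℝ} (hx : 0 < x) (β : ℝ) :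
    AnalyticAt ℝ (fun y : ℝ => y ^ β) x := by
  have h : AnalyticAt ℝ (fun y : ℝ => Real.exp (Real.log y * β)) x :=
    ((analyticAt_log hx).mul analyticAt_const).rexp
  refine h.congr ?_
  filter_upwards [eventually_gt_nhds hx] with y hy
  rw [Real.rpow_def_of_pos hy]

theorem hasSum_natCast_extend {c : ℕ → ℝ} {t y : ℝ} (h : HasSum (fun m => c m * t ^ m) y) :
    HasSum (fun τ : ℝ≥0 => Function.extend ((↑) : ℕ → ℝ≥0) c 0 τ * t ^ (τ : ℝ)) y := by
  have hinj : Function.Injective ((↑) : ℕ → ℝ≥0) := Nat.cast_injective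
  rw [← hinj.hasSum_iff]
  · refine h.congr_fun fun m => ?_
    simp [hinj.extend_apply]
  · intro τ hτ
    rw [Function.extend_apply' _ _ _ hτ, Pi.zero_apply, zero_mul]

variable {ι : Type*} [Fintype ι]

/-- Substitution of a power of one variable. -/
theorem IsGenAnalyticAt.comp_update_rpow [DecidableEq ι] {g : (ι → ℝ≥0) → ℝ} {a : ι → ℝ≥0}
    (hg : IsGenAnalyticAt g a) (i : ι) {β : ℝ} (hβ : 0 < β) {b : ℝ≥0} (hb : b ^ β = a i) :
    IsGenAnalyticAt (fun w => g (Function.update w i (w i ^ β))) (Function.update a i b) := by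
  have hθ : Tendsto (fun w : ℝ≥0 => w ^ β) (𝓝 b) (𝓝 (a i)) := by
    rw [← hb]
    exact (NNReal.continuous_rpow_const hβ.le).tendsto b
  -- At `b = 0` the substitution only rescales the exponents, `κ ↦ β * κ`. At `b ≠ 0` the exponents
  -- of the variable are natural, and the powers of `w ^ β - b ^ β`, an analytic function vanishing
  -- at `b`, are expanded instead.
  by_cases hb0 : b = 0
  · subst hb0
    have ha : a i = 0 := by rw [← hb, NNReal.zero_rpow hβ.ne']
    lift β to ℝ≥0 using hβ.le
    have hβ' : 0 < β := hβ
    have hterm : ∀ (κ : ℝ≥0) (t : ℝ), HasSum (fun τ : ℝ≥0 =>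
        (if τ = β * κ then (1 : ℝ) else 0) * t ^ (τ : ℝ)) (t ^ ((β * κ : ℝ≥0) : ℝ)) :=
      fun κ t => by
      convert hasSum_single (f := fun τ : ℝ≥0 =>
        (if τ = β * κ then (1 : ℝ) else 0) * t ^ (τ : ℝ)) (β * κ) ?_ using 1
      · simp
      · intro τ hτ; simp [hτ]
    refine hg.comp_update i (K := Set.univ) (e := fun κ τ => if τ = β * κ then 1 else 0) hθ
      (fun _ _ => trivial) (fun ρ hρ => ?_) ?_ (fun h => absurd rfl h) ?_
    · refine ⟨ρ ^ (β : ℝ)⁻¹, by positivity, fun κ _ => ?_⟩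
      have h := hterm κ (ρ ^ (β : ℝ)⁻¹)
      have h' : HasSum (fun τ : ℝ≥0 => |(if τ = β * κ then (1 : ℝ) else 0)| *
          (ρ ^ (β : ℝ)⁻¹) ^ (τ : ℝ)) (ρ ^ (κ : ℝ)) := by
        convert h using 1
        · ext τ; split_ifs <;> simp
        · rw [← Real.rpow_mul hρ.le, NNReal.coe_mul, ← mul_assoc, inv_mul_cancel₀ hβ.ne', one_mul]
      exact ⟨h'.summable, h'.tsum_eq.le⟩
    · refine Eventually.of_forall fun w κ _ => ?_
      have h := hterm κ w
      simpa [ha, Real.rpow_mul] using h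
    · intro W hW
      have : {τ | ∃ κ ∈ W, κ ∈ Set.univ ∧ (if τ = β * κ then (1 : ℝ) else 0) ≠ 0} =
          (fun κ => β * κ) '' W := by
        ext τ
        simp [eq_comm]
      rw [this]
      exact (hW.isPWO.image_of_monotone fun x y h => mul_le_mul_right h β).isWF
  · have hb' : (0 : ℝ) < b := by positivity
    have ha : a i ≠ 0 := by rw [← hb]; simp [NNReal.rpow_eq_zero_iff, hb0]
    have hF : AnalyticAt ℝ (fun w : ℝ => w ^ β - a i) b :=
      (analyticAt_rpow_const hb' β).sub analyticAt_const
    obtain ⟨C, hC, hCs⟩ := exists_coeff_pow hF (by rw [← hb]; simp)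
    have hinj : Function.Injective ((↑) : ℕ → ℝ≥0) := Nat.cast_injective
    let e : ℝ≥0 → ℝ≥0 → ℝ := fun κ =>
      Function.extend ((↑) : ℕ → ℝ≥0) (C (Nat.floor κ)) 0
    have he : ∀ κ τ, e κ τ ≠ 0 → τ ∈ Set.range ((↑) : ℕ → ℝ≥0) := fun κ τ h => by
      by_contra hτ
      exact h (Function.extend_apply' _ _ _ hτ)
    refine hg.comp_update i (K := Set.range ((↑) : ℕ → ℝ≥0)) (e := e) hθ
      (fun κ h => ?_) (fun ρ hρ => ?_) ?_ ?_ ?_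
    · obtain ⟨k, hk⟩ := h ha
      exact ⟨k, hk.symm⟩
    · obtain ⟨σ, hσ, h⟩ := hC ρ hρ
      refine ⟨σ, hσ, ?_⟩
      rintro _ ⟨k, rfl⟩
      have h' : HasSum (fun τ : ℝ≥0 => |e k τ| * σ ^ (τ : ℝ)) (∑' m, |C k m| * σ ^ m) := by
        refine (hasSum_natCast_extend (h k).1.hasSum).congr_fun fun τ => ?_
        congr 1
        simp only [e, Nat.floor_natCast]
        by_cases hτ : τ ∈ Set.range ((↑) : ℕ → ℝ≥0)
        · obtain ⟨m, rfl⟩ := hτ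
          rw [hinj.extend_apply, hinj.extend_apply]
        · rw [Function.extend_apply' _ _ _ hτ, Function.extend_apply' _ _ _ hτ]
          simp
      refine ⟨h'.summable, ?_⟩
      rw [h'.tsum_eq]
      simpa using (h k).2
    · have hcoe : Tendsto ((↑) : ℝ≥0 → ℝ) (𝓝 b) (𝓝 (b : ℝ)) :=
        NNReal.continuous_coe.tendsto b
      filter_upwards [hcoe.eventually hCs] with w hw
      rintro _ ⟨k, rfl⟩
      have := hasSum_natCast_extend (hw k)
      simpa [e] using this
    · intro _ κ _ τ hτ
      obtain ⟨k, hk⟩ := he κ τ hτ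
      exact ⟨k, hk.symm⟩
    · intro W _
      refine isWF_range_natCast.mono ?_
      rintro τ ⟨κ, _, _, hτ⟩
      exact he κ τ hτ

/-- Substitution of powers of the variables. -/
theorem IsGenAnalyticAt.comp_rpow {g : (ι → ℝ≥0) → ℝ} {β : ι → ℝ} (hβ : ∀ i, 0 < β i)
    {b : ι → ℝ≥0} (hg : IsGenAnalyticAt g fun i => b i ^ β i) :
    IsGenAnalyticAt (fun w => g fun i => w i ^ β i) b := by
  classical
  have key : ∀ t : Finset ι, IsGenAnalyticAt
      (fun w => g fun i => if i ∈ t then w i ^ β i else w i)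
      (fun i => if i ∈ t then b i else b i ^ β i) := by
    intro t
    induction t using Finset.induction_on with
    | empty => simpa using hg
    | insert i t hi ih =>
      have h := ih.comp_update_rpow i (hβ i) (b := b i) (by simp [hi])
      convert h using 1
      · ext w
        congr 1
        ext j
        by_cases hj : j = i
        · subst hj; simp [hi]
        · simp [hj]
      · ext j
        by_cases hj : j = i
        · subst hj; simp
        · simp [hj]
  simpa using key Finset.univ

end PowerSubstitution

/-! ### Transition functions between local charts. -/

section Charts

open Filter

variable {M : Type*} [TopologicalSpace M] {ι κ : Type*} [Fintype ι] [Fintype κ]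
  {n : ℕ} {S : FunctionSheaf M} {V V' : Set M} {φ : V → ι → ℝ≥0} {ψ : V' → κ → ℝ≥0}

theorem isStdAnalyticAt_coord (j : ι) (a : ι → ℝ≥0) :
    IsStdAnalyticAt (fun y : ι → ℝ≥0 => (y j : ℝ)) a :=
  ⟨fun z => z j, (ContinuousLinearMap.proj (R := ℝ) (φ := fun _ : ι => ℝ) j).analyticAt _,
    Eventually.of_forall fun _ => rfl⟩

theorem Kind.analyticAt_coord (𝒜 : Kind) (j : ι) (a : ι → ℝ≥0) :
    𝒜.AnalyticAt (fun y : ι → ℝ≥0 => (y j : ℝ)) a := by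
  cases 𝒜
  · exact isStdAnalyticAt_coord j a
  · exact (isStdAnalyticAt_coord j a).isGenAnalyticAt

namespace IsLocalChart

/-- A coordinate of `ψ` is itself a section of the sheaf over the overlap, hence is a model function
when read in `φ`. -/
theorem exists_transition {𝒜 : Kind} (hφ : IsLocalChart 𝒜 n S V φ) (hψ : IsLocalChart 𝒜 n S V' ψ)
    (j : κ) : ∃ g : (ι → ℝ≥0) → ℝ, ∀ (x : M) (hx : x ∈ V) (hx' : x ∈ V'),
      g (φ ⟨x, hx⟩) = ψ ⟨x, hx'⟩ j ∧ 𝒜.AnalyticAt g (φ ⟨x, hx⟩) := by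
  let U : Opens M := ⟨V ∩ V', hφ.isOpen.inter hψ.isOpen⟩
  have hU : (U : Set M) ⊆ V := Set.inter_subset_left
  have hU' : (U : Set M) ⊆ V' := Set.inter_subset_right
  let f : C(U, ℝ) := ⟨fun x => ψ ⟨x, hU' x.2⟩ j, by
    have := hψ.isOpenEmbedding.continuous
    fun_prop⟩
  have hf : f ∈ S.sections U := (hψ.mem_sections_iff U hU' f).2
    ⟨fun y => y j, fun x => ⟨rfl, 𝒜.analyticAt_coord j _⟩⟩
  obtain ⟨g, hg⟩ := (hφ.mem_sections_iff U hU f).1 hf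
  exact ⟨g, fun x hx hx' => hg ⟨x, hx, hx'⟩⟩

theorem tendsto {𝒜 : Kind} (hφ : IsLocalChart 𝒜 n S V φ) {m : M} (hm : m ∈ V)
    {p : (ι → ℝ≥0) → Prop} (hp : ∀ᶠ y in 𝓝 (φ ⟨m, hm⟩), p y) :
    ∀ᶠ x in 𝓝 m, ∃ hx : x ∈ V, p (φ ⟨x, hx⟩) := by
  have h := hφ.isOpenEmbedding.continuous.continuousAt.eventually hp
  rw [nhds_subtype_eq_comap, eventually_comap] at h
  filter_upwards [h, hφ.isOpen.mem_nhds hm] with x hx hxV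
  exact ⟨hxV, hx ⟨x, hxV⟩ rfl⟩

theorem eventually_exists {𝒜 : Kind} (hφ : IsLocalChart 𝒜 n S V φ) {m : M} (hm : m ∈ V)
    {p : M → Prop} (hp : ∀ᶠ x in 𝓝 m, p x) :
    ∀ᶠ y in 𝓝 (φ ⟨m, hm⟩), ∃ (x : M) (hx : x ∈ V), p x ∧ φ ⟨x, hx⟩ = y := by
  have h : ∀ᶠ x : V in 𝓝 ⟨m, hm⟩, p x := continuous_subtype_val.continuousAt.eventually hp
  have h2 := hφ.isOpenEmbedding.isOpenMap.image_mem_nhds h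
  filter_upwards [h2]
  rintro _ ⟨x, hx, rfl⟩
  exact ⟨x, x.2, hx, rfl⟩

theorem eventually_exists_real {𝒜 : Kind} (hφ : IsLocalChart 𝒜 n S V φ) {m : M} (hm : m ∈ V)
    {p : M → Prop} (hp : ∀ᶠ x in 𝓝 m, p x) :
    ∀ᶠ z : ι → ℝ in 𝓝 fun i => (φ ⟨m, hm⟩ i : ℝ), (∀ i, 0 ≤ z i) →
      ∃ (x : M) (hx : x ∈ V), p x ∧ ∀ i, (φ ⟨x, hx⟩ i : ℝ) = z i := by
  have hc : Continuous fun z : ι → ℝ => fun i => (z i).toNNReal := by fun_prop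
  have h := hc.tendsto fun i => (φ ⟨m, hm⟩ i : ℝ)
  simp only [Real.toNNReal_coe] at h
  filter_upwards [h.eventually (hφ.eventually_exists hm hp)] with z hz hz0
  obtain ⟨x, hx, hpx, hxz⟩ := hz
  exact ⟨x, hx, hpx, fun i => by rw [hxz, Real.coe_toNNReal _ (hz0 i)]⟩

/-- Arbitrarily close to a point where the coordinates in `J` vanish there are points where no
other coordinate vanishes. -/
theorem exists_zero_iff {𝒜 : Kind} (hφ : IsLocalChart 𝒜 n S V φ) {m : M} (hm : m ∈ V)
    {p : M → Prop} (hp : ∀ᶠ x in 𝓝 m, p x) {J : Set ι} (hJ : ∀ i ∈ J, φ ⟨m, hm⟩ i = 0) :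
    ∃ (x : M) (hx : x ∈ V), p x ∧ ∀ i, φ ⟨x, hx⟩ i = 0 ↔ i ∈ J := by
  classical
  have hc : Continuous fun t : ℝ≥0 => fun i => φ ⟨m, hm⟩ i + if i ∈ J then 0 else t := by
    refine continuous_pi fun i => ?_
    split_ifs <;> fun_prop
  have h := hc.tendsto 0
  simp only [ite_self, add_zero] at h
  have h2 := (h.eventually (hφ.eventually_exists hm hp)).filter_mono
    (nhdsWithin_le_nhds (s := Set.Ioi 0))
  obtain ⟨t, ⟨x, hx, hpx, hxt⟩, ht⟩ := (h2.and eventually_mem_nhdsWithin).exists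
  refine ⟨x, hx, hpx, fun i => ?_⟩
  rw [hxt]
  by_cases hi : i ∈ J
  · simp [hi, hJ i hi]
  · simpa [hi] using fun _ => (Set.mem_Ioi.1 ht).ne'

/-- The coordinates of a generalized chart are analytic functions of those of another one, along
the intersection of the boundary hypersurfaces through the point. -/
theorem exists_analyticAt_transition (hφ : IsLocalChart .generalized n S V φ)
    (hψ : IsLocalChart .generalized n S V' ψ) {m : M} (hm : m ∈ V) (hm' : m ∈ V') :
    ∃ F : κ → (ι → ℝ) → ℝ, ∀ j, AnalyticAt ℝ (F j) (fun i => (φ ⟨m, hm⟩ i : ℝ)) ∧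
      ∀ᶠ x in 𝓝 m, ∃ (hx : x ∈ V) (hx' : x ∈ V'),
        (∀ i, φ ⟨m, hm⟩ i = 0 → φ ⟨x, hx⟩ i = 0) →
          (ψ ⟨x, hx'⟩ j : ℝ) = F j fun i => (φ ⟨x, hx⟩ i : ℝ) := by
  have : ∀ j, ∃ F : (ι → ℝ) → ℝ, AnalyticAt ℝ F (fun i => (φ ⟨m, hm⟩ i : ℝ)) ∧
      ∀ᶠ x in 𝓝 m, ∃ (hx : x ∈ V) (hx' : x ∈ V'),
        (∀ i, φ ⟨m, hm⟩ i = 0 → φ ⟨x, hx⟩ i = 0) →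
          (ψ ⟨x, hx'⟩ j : ℝ) = F fun i => (φ ⟨x, hx⟩ i : ℝ) := by
    intro j
    obtain ⟨g, hg⟩ := hφ.exists_transition hψ j
    obtain ⟨F, hF, hgF⟩ := IsGenAnalyticAt.exists_analyticAt (hg m hm hm').2
    refine ⟨F, hF, ?_⟩
    filter_upwards [hφ.tendsto hm hgF, hψ.isOpen.mem_nhds hm'] with x ⟨hx, hxF⟩ hx'
    exact ⟨hx, hx', fun h0 => by rw [← hxF h0, (hg x hx hx').1]⟩
  choose F hF using this
  exact ⟨F, hF⟩

end IsLocalChart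

end Charts

/-! ### Invariance of interior points and of codimension-one points under change of chart. -/

section Charts

open Filter

/-- The fibre of a submersion of positive corank contains an injective curve. -/
theorem exists_curve_in_fiber {E F : Type*} [NormedAddCommGroup E] [NormedSpace ℝ E]
    [FiniteDimensional ℝ E] [NormedAddCommGroup F] [NormedSpace ℝ F] [FiniteDimensional ℝ F]
    {P : E → F} {A : E →L[ℝ] F} {a : E} (hP : HasStrictFDerivAt P A a)
    (hA : Function.Surjective A) (hd : Module.finrank ℝ F < Module.finrank ℝ E) :
    ∃ c : ℝ → E, c 0 = a ∧ (∀ᶠ t in 𝓝 0, ContinuousAt c t ∧ P (c t) = P a) ∧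
      ∃ U ∈ 𝓝 (0 : ℝ), Set.InjOn c U := by
  have : CompleteSpace E := FiniteDimensional.complete ℝ E
  have hA' : A.range = ⊤ := LinearMap.range_eq_top.2 hA
  let Θ := hP.implicitToOpenPartialHomeomorph P A hA'
  obtain ⟨v, hv⟩ : ∃ v : A.ker, v ≠ 0 := by
    have hker : A.ker ≠ ⊥ := LinearMap.ker_ne_bot_of_finrank_lt (f := (A : E →ₗ[ℝ] F)) hd
    obtain ⟨v, hv, hv0⟩ := Submodule.exists_mem_ne_zero_of_ne_bot hker
    exact ⟨⟨v, hv⟩, fun h => hv0 (congrArg Subtype.val h)⟩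
  -- The implicit function chart straightens the fibres of `P`; in it the curve is a line in a
  -- kernel direction.
  let l : ℝ → F × A.ker := fun t => (P a, t • v)
  have hl : Continuous l := by fun_prop
  have hl0 : l 0 = Θ a := by simp [l, Θ]
  have ht0 : l 0 ∈ Θ.target := by
    rw [hl0]
    exact Θ.map_source (hP.mem_implicitToOpenPartialHomeomorph_source hA')
  have htgt : ∀ᶠ t in 𝓝 0, l t ∈ Θ.target :=
    hl.continuousAt.eventually (Θ.open_target.mem_nhds ht0)
  refine ⟨fun t => Θ.symm (l t), ?_, ?_, _, htgt, ?_⟩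
  · change Θ.symm (l 0) = a
    rw [hl0, Θ.left_inv (hP.mem_implicitToOpenPartialHomeomorph_source hA')]
  · filter_upwards [htgt] with t ht
    refine ⟨(Θ.symm.continuousAt ht).comp hl.continuousAt, ?_⟩
    have := hP.implicitToOpenPartialHomeomorph_fst hA' (Θ.symm (l t))
    rw [← this]
    change (Θ (Θ.symm (l t))).1 = P a
    rw [Θ.right_inv ht]
  · intro t ht t' ht' h
    have h1 := congrArg Prod.snd (Θ.symm.injOn ht ht' h)
    exact smul_left_injective ℝ hv h1

/-- An injective continuous function of one variable has no interior minimum. -/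
theorem not_injOn_of_interior_min {f : ℝ → ℝ} {δ : ℝ} (hδ : 0 < δ)
    (hf : ContinuousOn f (Set.Icc (-δ) δ)) (h0 : ∀ t ∈ Set.Icc (-δ) δ, f 0 ≤ f t) :
    ¬ Set.InjOn f (Set.Icc (-δ) δ) := by
  intro hinj
  have hm1 : -δ ∈ Set.Icc (-δ) δ := ⟨le_rfl, by linarith⟩
  have hm2 : δ ∈ Set.Icc (-δ) δ := ⟨by linarith, le_rfl⟩
  have hm0 : (0 : ℝ) ∈ Set.Icc (-δ) δ := ⟨by linarith, hδ.le⟩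
  rcases hf.strictMonoOn_of_injOn_Icc' (by linarith) hinj with h | h
  · exact (h hm1 hm0 (by linarith)).not_ge (h0 _ hm1)
  · exact (h hm0 hm2 hδ).not_ge (h0 _ hm2)

variable {M : Type*} [TopologicalSpace M] {ι κ : Type*} [Fintype ι] [Fintype κ]
  {n : ℕ} {S : FunctionSheaf M} {V V' : Set M} {φ : V → ι → ℝ≥0} {ψ : V' → κ → ℝ≥0}

namespace IsLocalChart

/-- Around `m` all `ψ`-coordinates are analytic in the open set of `φ`-coordinates. Those other than
`j₀` form a submersion onto a space of dimension one less, so a curve through `m` lies in a fibre.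
Along it the coordinate `j₀` is injective, as `ψ` is, yet nonnegative and zero at `m`: an interior
minimum, which is impossible. -/
theorem not_zero_iff_of_forall_ne_zero (hφ : IsLocalChart .generalized n S V φ)
    (hψ : IsLocalChart .generalized n S V' ψ) {m : M} (hm : m ∈ V) (hm' : m ∈ V')
    (h0 : ∀ i, φ ⟨m, hm⟩ i ≠ 0) (j₀ : κ) : ¬ ∀ j, ψ ⟨m, hm'⟩ j = 0 ↔ j = j₀ := by
  classical
  intro h1
  obtain ⟨F, hF⟩ := hφ.exists_analyticAt_transition hψ hm hm'
  obtain ⟨G, hG⟩ := hψ.exists_analyticAt_transition hφ hm' hm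
  set a : ι → ℝ := fun i => (φ ⟨m, hm⟩ i : ℝ) with ha
  set b : κ → ℝ := fun j => (ψ ⟨m, hm'⟩ j : ℝ) with hb
  have ha0 : ∀ i, 0 < a i := fun i => by
    simpa [a, pos_iff_ne_zero] using h0 i
  have hF' : ∀ᶠ x in 𝓝 m, ∃ (hx : x ∈ V) (hx' : x ∈ V'), ∀ j,
      (ψ ⟨x, hx'⟩ j : ℝ) = F j fun i => (φ ⟨x, hx⟩ i : ℝ) := by
    filter_upwards [hφ.isOpen.mem_nhds hm, hψ.isOpen.mem_nhds hm',
      eventually_all.2 fun j => (hF j).2] with x hx hx' h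
    refine ⟨hx, hx', fun j => ?_⟩
    obtain ⟨_, _, h⟩ := h j
    exact h fun i hi => absurd hi (h0 i)
  have hG' : ∀ᶠ x in 𝓝 m, ∃ (hx : x ∈ V) (hx' : x ∈ V'), ψ ⟨x, hx'⟩ j₀ = 0 → ∀ i,
      (φ ⟨x, hx⟩ i : ℝ) = G i fun j => (ψ ⟨x, hx'⟩ j : ℝ) := by
    filter_upwards [hφ.isOpen.mem_nhds hm, hψ.isOpen.mem_nhds hm',
      eventually_all.2 fun i => (hG i).2] with x hx hx' h
    refine ⟨hx, hx', fun hx0 i => ?_⟩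
    obtain ⟨_, _, h⟩ := h i
    exact h fun j hj => by rwa [(h1 j).1 hj]
  -- the coordinates other than `j₀`
  let P : (ι → ℝ) → ({j // j ≠ j₀} → ℝ) := fun z j => F j z
  have hP : HasStrictFDerivAt P (fderiv ℝ P a) a :=
    AnalyticAt.hasStrictFDerivAt (analyticAt_pi_iff.2 fun j => (hF j).1)
  let L : ({j // j ≠ j₀} → ℝ) →L[ℝ] (κ → ℝ) := ContinuousLinearMap.pi fun j =>
    if h : j = j₀ then 0 else ContinuousLinearMap.proj ⟨j, h⟩
  have hL0 : ∀ w, L w j₀ = 0 := fun w => by simp [L]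
  have hLj : ∀ w (j : {j // j ≠ j₀}), L w j = w j := fun w j => by simp [L, j.2]
  let b' : {j // j ≠ j₀} → ℝ := fun j => b j
  have hLb : L b' = b := by
    ext j
    by_cases hj : j = j₀
    · subst hj
      rw [hL0]
      simp [b, (h1 j).2 rfl]
    · exact hLj b' ⟨j, hj⟩
  -- An analytic right inverse of `P`: it sends `w` to the `φ`-coordinates of the point of the face
  -- `ψ j₀ = 0` with remaining coordinates `w`. The transition `G` is known to be analytic only
  -- along that face, and that suffices to make the derivative of `P` surjective.
  let Q : ({j // j ≠ j₀} → ℝ) → (ι → ℝ) := fun w i => G i (L w)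
  have hb'0 : ∀ᶠ w in 𝓝 b', ∀ j, 0 ≤ w j := by
    rw [eventually_all]
    intro j
    have : 0 < b' j := by
      have : ψ ⟨m, hm'⟩ j ≠ 0 := fun h => j.2 ((h1 _).1 h)
      simpa [b', b, pos_iff_ne_zero] using this
    have h2 : Tendsto (fun w : {j // j ≠ j₀} → ℝ => w j) (𝓝 b') (𝓝 (b' j)) :=
      (continuous_apply j).tendsto b'
    exact (h2.eventually_const_lt this).mono fun _ h => h.le
  have hQb : Q b' = a := by
    obtain ⟨_, _, h⟩ := hG'.self_of_nhds
    ext i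
    have := h ((h1 j₀).2 rfl) i
    simp only [Q, hLb]
    exact this.symm
  have hPQ : ∀ᶠ w in 𝓝 b', P (Q w) = w := by
    have h := hψ.eventually_exists_real hm' (hF'.and hG')
    have hLt : Tendsto L (𝓝 b') (𝓝 b) := by
      rw [← hLb]; exact L.continuous.tendsto b'
    filter_upwards [hLt.eventually h, hb'0] with w hw hw0
    obtain ⟨x, hx', ⟨⟨hx, _, hxF⟩, ⟨_, _, hxG⟩⟩, hxw⟩ := hw fun j => by
      by_cases hj : j = j₀
      · rw [hj, hL0]
      · exact (hLj w ⟨j, hj⟩).symm ▸ hw0 ⟨j, hj⟩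
    have hxw' : (fun j => (ψ ⟨x, hx'⟩ j : ℝ)) = L w := funext hxw
    have hx0 : ψ ⟨x, hx'⟩ j₀ = 0 := by
      have := hxw j₀
      rw [hL0] at this
      exact_mod_cast this
    have hQw : Q w = fun i => (φ ⟨x, hx⟩ i : ℝ) := by
      ext i
      rw [hxG hx0 i, hxw']
    ext j
    simp only [P, hQw]
    rw [← hxF j, hxw, hLj]
  have hQd : HasFDerivAt Q (fderiv ℝ Q b') b' := by
    have : AnalyticAt ℝ Q b' := analyticAt_pi_iff.2 fun i => by
      refine AnalyticAt.fun_comp ?_ (L.analyticAt b')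
      rw [hLb]
      exact (hG i).1
    exact this.differentiableAt.hasFDerivAt
  have hcomp : (fderiv ℝ P a).comp (fderiv ℝ Q b') = ContinuousLinearMap.id ℝ _ := by
    have h2 : HasFDerivAt (fun w => P (Q w)) ((fderiv ℝ P a).comp (fderiv ℝ Q b')) b' := by
      have h3 : HasFDerivAt P (fderiv ℝ P a) (Q b') := by
        rw [hQb]
        exact hP.hasFDerivAt
      exact h3.comp b' hQd
    exact h2.unique ((hasFDerivAt_id (𝕜 := ℝ) b').congr_of_eventuallyEq hPQ)
  have hsurj : Function.Surjective (fderiv ℝ P a) := fun w =>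
    ⟨fderiv ℝ Q b' w, by
      have := DFunLike.congr_fun hcomp w
      simpa using this⟩
  have hcard : Module.finrank ℝ ({j // j ≠ j₀} → ℝ) < Module.finrank ℝ (ι → ℝ) := by
    rw [Module.finrank_fintype_fun_eq_card, Module.finrank_fintype_fun_eq_card, hφ.card_eq,
      ← hψ.card_eq]
    exact Fintype.card_subtype_lt (x := j₀) (by simp)
  obtain ⟨c, hc0, hc, U, hU, hcU⟩ := exists_curve_in_fiber hP hsurj hcard
  have hcc : Tendsto c (𝓝 0) (𝓝 a) := by
    have := hc.self_of_nhds.1.tendsto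
    rwa [hc0] at this
  have hreal : ∀ᶠ t in 𝓝 0, ∃ (x : M) (hx : x ∈ V) (hx' : x ∈ V'),
      (∀ j, (ψ ⟨x, hx'⟩ j : ℝ) = F j (c t)) ∧ ∀ i, (φ ⟨x, hx⟩ i : ℝ) = c t i := by
    have hpos : ∀ᶠ z in 𝓝 a, ∀ i, 0 ≤ z i := by
      rw [eventually_all]
      intro i
      have h2 : Tendsto (fun z : ι → ℝ => z i) (𝓝 a) (𝓝 (a i)) := (continuous_apply i).tendsto a
      exact (h2.eventually_const_lt (ha0 i)).mono fun _ h => h.le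
    filter_upwards [hcc.eventually (hφ.eventually_exists_real hm hF'), hcc.eventually hpos]
      with t ht ht0
    obtain ⟨x, hx, ⟨_, hx', hxF⟩, hxc⟩ := ht ht0
    refine ⟨x, hx, hx', fun j => ?_, hxc⟩
    rw [hxF j, funext hxc]
  have hcont : ∀ᶠ t in 𝓝 0, ContinuousAt (F j₀) (c t) :=
    hcc.eventually ((hF j₀).1.eventually_analyticAt.mono fun z hz => hz.continuousAt)
  have hall := (hc.and (hreal.and hcont)).and hU
  obtain ⟨δ, hδ, hball⟩ := Metric.nhds_basis_closedBall.eventually_iff.1 hall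
  rw [Real.closedBall_eq_Icc, zero_sub, zero_add] at hball
  have hfa : F j₀ a = 0 := by
    obtain ⟨_, _, h⟩ := hF'.self_of_nhds
    rw [← h j₀, (h1 j₀).2 rfl, NNReal.coe_zero]
  refine not_injOn_of_interior_min (f := fun t => F j₀ (c t)) hδ (fun t ht => ?_)
    (fun t ht => ?_) (fun t ht t' ht' h => ?_)
  · have := hball ht
    exact (ContinuousAt.comp this.1.2.2 this.1.1.1).continuousWithinAt
  · obtain ⟨⟨_, ⟨x, hx, hx', hxF, _⟩, _⟩, _⟩ := hball ht
    rw [hc0, hfa, ← hxF]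
    exact NNReal.coe_nonneg _
  · obtain ⟨⟨⟨_, hPt⟩, ⟨x, hx, hx', hxF, hxc⟩, _⟩, htU⟩ := hball ht
    obtain ⟨⟨⟨_, hPt'⟩, ⟨y, hy, hy', hyF, hyc⟩, _⟩, htU'⟩ := hball ht'
    refine hcU htU htU' ?_
    have hxy : ψ ⟨x, hx'⟩ = ψ ⟨y, hy'⟩ := by
      ext j
      rw [hxF, hyF]
      by_cases hj : j = j₀
      · rw [hj]; exact h
      · have := congrFun (hPt.trans hPt'.symm) ⟨j, hj⟩
        exact this
    obtain rfl : x = y := congrArg Subtype.val (hψ.isOpenEmbedding.injective hxy)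
    ext i
    rw [← hxc, ← hyc]

/-- A point that is interior in one chart is interior in every chart. -/
theorem forall_ne_zero (hφ : IsLocalChart .generalized n S V φ)
    (hψ : IsLocalChart .generalized n S V' ψ) {m : M} (hm : m ∈ V) (hm' : m ∈ V')
    (h0 : ∀ i, φ ⟨m, hm⟩ i ≠ 0) (j : κ) : ψ ⟨m, hm'⟩ j ≠ 0 := by
  intro hj
  -- Being interior for `φ` is an open condition, so `m` may be moved to a point where `j` is the
  -- only vanishing coordinate of `ψ`.
  have hev : ∀ᶠ x in 𝓝 m, ∃ hx : x ∈ V, ∀ i, φ ⟨x, hx⟩ i ≠ 0 :=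
    hφ.tendsto hm (p := fun y => ∀ i, y i ≠ 0) <| eventually_all.2 fun i =>
      ((continuous_apply (A := fun _ : ι => ℝ≥0) i).tendsto _).eventually_ne (h0 i)
  obtain ⟨x, hx', ⟨hx, hx0⟩, hxj⟩ := hψ.exists_zero_iff hm' hev (J := {j}) (by simpa using hj)
  exact hφ.not_zero_iff_of_forall_ne_zero hψ hx hx' hx0 j (by simpa using hxj)

/-- Locally the smooth face `φ k₀ = 0` would equal the union of the two faces `ψ j₀ = 0` and `ψ j₁ =
0`. On a segment of the first face that joins points lying on only one of the latter, the two
analytic functions `ψ j₀` and `ψ j₁` have product zero, so one vanishes identically, contradicting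
its value at an endpoint. -/
theorem not_zero_iff_pair (hφ : IsLocalChart .generalized n S V φ)
    (hψ : IsLocalChart .generalized n S V' ψ) {m : M} (hm : m ∈ V) (hm' : m ∈ V') {k₀ : ι}
    (h0 : ∀ i, φ ⟨m, hm⟩ i = 0 ↔ i = k₀) {j₀ j₁ : κ} (hj : j₀ ≠ j₁) :
    ¬ ∀ j, ψ ⟨m, hm'⟩ j = 0 ↔ j = j₀ ∨ j = j₁ := by
  classical
  intro h1
  set a : ι → ℝ := fun i => (φ ⟨m, hm⟩ i : ℝ) with ha
  let N : M → Prop := fun x => ∃ (hx : x ∈ V) (hx' : x ∈ V'),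
    (∀ i, i ≠ k₀ → φ ⟨x, hx⟩ i ≠ 0) ∧ ∀ j, j ≠ j₀ → j ≠ j₁ → ψ ⟨x, hx'⟩ j ≠ 0
  have hN : ∀ᶠ x in 𝓝 m, N x := by
    have e1 : ∀ᶠ x in 𝓝 m, ∃ hx : x ∈ V, ∀ i, i ≠ k₀ → φ ⟨x, hx⟩ i ≠ 0 :=
      hφ.tendsto hm (p := fun y => ∀ i, i ≠ k₀ → y i ≠ 0) <| eventually_all.2 fun i =>
        eventually_imp_distrib_left.2 fun hi =>
        ((continuous_apply (A := fun _ : ι => ℝ≥0) i).tendsto _).eventually_ne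
          (mt (h0 i).1 hi)
    have e2 : ∀ᶠ x in 𝓝 m, ∃ hx : x ∈ V', ∀ j, j ≠ j₀ → j ≠ j₁ → ψ ⟨x, hx⟩ j ≠ 0 :=
      hψ.tendsto hm' (p := fun y => ∀ j, j ≠ j₀ → j ≠ j₁ → y j ≠ 0) <| eventually_all.2 fun j =>
        eventually_imp_distrib_left.2 fun hi => eventually_imp_distrib_left.2 fun hi' =>
        ((continuous_apply (A := fun _ : κ => ℝ≥0) j).tendsto _).eventually_ne
          (mt (h1 j).1 (by tauto))
    filter_upwards [e1, e2] with x ⟨hx, h⟩ ⟨hx', h'⟩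
    exact ⟨hx, hx', h, h'⟩
  obtain ⟨ε, hε, hball⟩ := Metric.eventually_nhds_iff.1 (hφ.eventually_exists_real hm hN)
  have hdist : ∀ᶠ x in 𝓝 m, ∃ hx : x ∈ V, dist (fun i => (φ ⟨x, hx⟩ i : ℝ)) a < ε := by
    refine hφ.tendsto hm (p := fun y => dist (fun i => (y i : ℝ)) a < ε) ?_
    have hc : Continuous fun y : ι → ℝ≥0 => fun i => (y i : ℝ) := by fun_prop
    exact hc.continuousAt.eventually (Metric.ball_mem_nhds a hε)
  have hpick : ∀ j : κ, (j = j₀ ∨ j = j₁) → ∃ (x : M) (hx : x ∈ V) (hx' : x ∈ V'),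
      dist (fun i => (φ ⟨x, hx⟩ i : ℝ)) a < ε ∧ (∀ i, φ ⟨x, hx⟩ i = 0 ↔ i = k₀) ∧
        ∀ j', ψ ⟨x, hx'⟩ j' = 0 ↔ j' = j := by
    intro j hjj
    obtain ⟨x, hx', ⟨⟨hx, hxd⟩, ⟨_, _, hx1, _⟩⟩, hxj⟩ :=
      hψ.exists_zero_iff hm' (hdist.and hN) (J := {j}) (by simpa using (h1 j).2 hjj)
    have hxj : ∀ j', ψ ⟨x, hx'⟩ j' = 0 ↔ j' = j := by simpa using hxj
    refine ⟨x, hx, hx', hxd, fun i => ⟨fun hi => ?_, fun hi => ?_⟩, hxj⟩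
    · by_contra h
      exact hx1 i h hi
    · subst hi
      by_contra h
      refine hφ.forall_ne_zero hψ hx hx' (fun i' => ?_) j ((hxj j).2 rfl)
      by_cases hi' : i' = i
      · rwa [hi']
      · exact hx1 i' hi'
  obtain ⟨x, hx, hx', hxd, hxz, hxj⟩ := hpick j₀ (Or.inl rfl)
  obtain ⟨y, hy, hy', hyd, hyz, hyj⟩ := hpick j₁ (Or.inr rfl)
  let z : ℝ → ι → ℝ := fun t => AffineMap.lineMap
    (fun i => (φ ⟨x, hx⟩ i : ℝ)) (fun i => (φ ⟨y, hy⟩ i : ℝ)) t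
  have hzapp : ∀ t i, z t i = (φ ⟨x, hx⟩ i : ℝ) + t * ((φ ⟨y, hy⟩ i : ℝ) - φ ⟨x, hx⟩ i) := by
    intro t i
    simp [z, AffineMap.lineMap_apply]; ring
  have hzan : ∀ t, AnalyticAt ℝ z t := fun t => by
    refine analyticAt_pi_iff.2 fun i => ?_
    have : (fun t => z t i) =
        fun t => (φ ⟨x, hx⟩ i : ℝ) + t * ((φ ⟨y, hy⟩ i : ℝ) - φ ⟨x, hx⟩ i) :=
      funext fun t => hzapp t i
    change AnalyticAt ℝ (fun t => z t i) t
    rw [this]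
    fun_prop
  have hzk : ∀ t, z t k₀ = 0 := fun t => by
    rw [hzapp, (hxz k₀).2 rfl, (hyz k₀).2 rfl]; simp
  -- Convexity of `C` makes the parameter set `U` of the segment connected, as the identity theorem
  -- requires.
  let C : Set (ι → ℝ) := Metric.ball a ε ∩ {w | ∀ i, i ≠ k₀ → 0 < w i}
  have hC : Convex ℝ C := (convex_ball a ε).inter fun u hu v hv s t hs ht hst i hi => by
    have hu := hu i hi
    have hv := hv i hi
    rcases hs.eq_or_lt with rfl | hs
    · obtain rfl : t = 1 := by linarith
      simpa using hv
    · have := mul_pos hs hu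
      have := mul_nonneg ht hv.le
      simp only [Pi.add_apply, Pi.smul_apply, smul_eq_mul]
      linarith
  let U : Set ℝ := z ⁻¹' C
  have hU : IsPreconnected U :=
    (hC.affine_preimage (AffineMap.lineMap (k := ℝ) (fun i => (φ ⟨x, hx⟩ i : ℝ))
      (fun i => (φ ⟨y, hy⟩ i : ℝ)))).isPreconnected
  have hUx : ∀ t ∈ U, ∃ (u : M) (hu : u ∈ V) (hu' : u ∈ V'),
      (∀ i, φ ⟨u, hu⟩ i = 0 ↔ i = k₀) ∧ (∀ i, (φ ⟨u, hu⟩ i : ℝ) = z t i) ∧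
      (ψ ⟨u, hu'⟩ j₀ = 0 ∨ ψ ⟨u, hu'⟩ j₁ = 0) := by
    intro t ht
    obtain ⟨u, hu, ⟨_, hu', hu1, hu2⟩, huz⟩ := hball ht.1 fun i => by
      by_cases hi : i = k₀
      · rw [hi, hzk]
      · exact (ht.2 i hi).le
    have huk : φ ⟨u, hu⟩ k₀ = 0 := by
      have := huz k₀
      rw [hzk] at this
      exact_mod_cast this
    have huiff : ∀ i, φ ⟨u, hu⟩ i = 0 ↔ i = k₀ := fun i =>
      ⟨fun hi => by_contra fun h => hu1 i h hi, fun hi => by rwa [hi]⟩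
    refine ⟨u, hu, hu', huiff, huz, ?_⟩
    by_contra! h
    refine hψ.not_zero_iff_of_forall_ne_zero hφ hu' hu (fun j => ?_) k₀ huiff
    by_cases hj0 : j = j₀
    · rw [hj0]; exact h.1
    by_cases hj1 : j = j₁
    · rw [hj1]; exact h.2
    exact hu2 j hj0 hj1
  choose g hg using fun j => hφ.exists_transition hψ j
  let f : κ → ℝ → ℝ := fun j t => g j fun i => (z t i).toNNReal
  have hzt : ∀ {t : ℝ} {u : M} {hu : u ∈ V}, (∀ i, (φ ⟨u, hu⟩ i : ℝ) = z t i) →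
      (fun i => (z t i).toNNReal) = φ ⟨u, hu⟩ := fun h => by
    ext i; rw [← h, Real.toNNReal_coe]
  have hfan : ∀ j, AnalyticOnNhd ℝ (f j) U := by
    intro j t ht
    obtain ⟨u, hu, hu', huz, hut, -⟩ := hUx t ht
    obtain ⟨F, hF, hgF⟩ := IsGenAnalyticAt.exists_analyticAt (hg j u hu hu').2
    rw [funext hut] at hF
    refine (hF.comp (hzan t)).congr ?_
    have hc : Continuous fun w : ι → ℝ => fun i => (w i).toNNReal := by fun_prop
    have hct : Tendsto (fun s => fun i => (z s i).toNNReal) (𝓝 t) (𝓝 (φ ⟨u, hu⟩)) := by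
      rw [← hzt hut]
      exact (hc.continuousAt.comp (hzan t).continuousAt)
    have hpos : ∀ᶠ s in 𝓝 t, ∀ i, i ≠ k₀ → 0 < z s i := eventually_all.2 fun i =>
      eventually_imp_distrib_left.2 fun hi =>
        ((continuous_apply i).continuousAt.comp (hzan t).continuousAt).eventually_const_lt
          (ht.2 i hi)
    filter_upwards [hct.eventually hgF, hpos] with s hs hs0
    simp only [f, Function.comp]
    rw [hs fun i hi => by rw [(huz i).1 hi, hzk, Real.toNNReal_zero]]
    congr 1
    ext i
    by_cases hi : i = k₀
    · rw [hi, hzk]; simp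
    · rw [Real.coe_toNNReal _ (hs0 i hi).le]
  have hfz : ∀ t ∈ U, f j₀ t * f j₁ t = 0 := by
    intro t ht
    obtain ⟨u, hu, hu', huz, hut, h⟩ := hUx t ht
    simp only [f, hzt hut, (hg _ u hu hu').1]
    rcases h with h | h <;> simp [h]
  have hpos' : ∀ {w : M} {hw : w ∈ V}, (∀ i, φ ⟨w, hw⟩ i = 0 ↔ i = k₀) →
      ∀ i, i ≠ k₀ → (0 : ℝ) < φ ⟨w, hw⟩ i := fun hwz i hi => by
    simpa [pos_iff_ne_zero] using mt (hwz i).1 hi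
  have hz0 : z 0 = fun i => (φ ⟨x, hx⟩ i : ℝ) := by simp [z]
  have hz1 : z 1 = fun i => (φ ⟨y, hy⟩ i : ℝ) := by simp [z]
  rcases AnalyticOnNhd.eq_zero_or_eq_zero_of_mul_eq_zero (hfan j₀) (hfan j₁) hfz hU with h | h
  · have h1 := h 1 (by
      change z 1 ∈ C
      rw [hz1]
      exact ⟨hyd, hpos' hyz⟩)
    simp only [f, hz1, Real.toNNReal_coe] at h1
    rw [(hg j₀ y hy hy').1] at h1
    exact hj ((hyj j₀).1 (by exact_mod_cast h1))
  · have h1 := h 0 (by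
      change z 0 ∈ C
      rw [hz0]
      exact ⟨hxd, hpos' hxz⟩)
    simp only [f, hz0, Real.toNNReal_coe] at h1
    rw [(hg j₁ x hx hx').1] at h1
    exact hj ((hxj j₁).1 (by exact_mod_cast h1)).symm

/-- A point with exactly one vanishing coordinate in some chart has exactly one in every chart. -/
theorem exists_zero_iff_eq (hφ : IsLocalChart .generalized n S V φ)
    (hψ : IsLocalChart .generalized n S V' ψ) {m : M} (hm : m ∈ V) (hm' : m ∈ V') {k₀ : ι}
    (h0 : ∀ i, φ ⟨m, hm⟩ i = 0 ↔ i = k₀) : ∃ j₀, ∀ j, ψ ⟨m, hm'⟩ j = 0 ↔ j = j₀ := by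
  classical
  obtain ⟨j₀, hj₀⟩ : ∃ j₀, ψ ⟨m, hm'⟩ j₀ = 0 := by
    by_contra! h
    exact hψ.forall_ne_zero hφ hm' hm h k₀ ((h0 k₀).2 rfl)
  refine ⟨j₀, fun j => ⟨fun hj => ?_, fun hj => by rwa [hj]⟩⟩
  by_contra hne
  have e1 : ∀ᶠ x in 𝓝 m, ∃ hx : x ∈ V, ∀ i, i ≠ k₀ → φ ⟨x, hx⟩ i ≠ 0 :=
    hφ.tendsto hm (p := fun y => ∀ i, i ≠ k₀ → y i ≠ 0) <| eventually_all.2 fun i =>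
      eventually_imp_distrib_left.2 fun hi =>
      ((continuous_apply (A := fun _ : ι => ℝ≥0) i).tendsto _).eventually_ne (mt (h0 i).1 hi)
  -- If more coordinates of `ψ` vanish, a nearby point has exactly the two zeros `j` and `j₀`.
  obtain ⟨x, hx', ⟨hx, hx1⟩, hxj⟩ := hψ.exists_zero_iff hm' e1 (J := {j, j₀}) (by
    rintro i (rfl | rfl) <;> assumption)
  have hxj : ∀ i, ψ ⟨x, hx'⟩ i = 0 ↔ i = j ∨ i = j₀ := by simpa using hxj
  have hk : φ ⟨x, hx⟩ k₀ = 0 := by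
    by_contra h
    refine hφ.forall_ne_zero hψ hx hx' (fun i => ?_) j ((hxj j).2 (Or.inl rfl))
    by_cases hi : i = k₀
    · rwa [hi]
    · exact hx1 i hi
  exact hφ.not_zero_iff_pair hψ hx hx'
    (fun i => ⟨fun hi => by_contra fun h => hx1 i h hi, fun hi => by rwa [hi]⟩) hne hxj

end IsLocalChart

end Charts

/-! ### Reindexed charts and charts with powers of the coordinates. -/

section ChangeOfCoordinates

open Filter

variable {M : Type*} [TopologicalSpace M] {ι κ : Type*} [Fintype ι] [Fintype κ]
  {n : ℕ} {S : FunctionSheaf M} {V : Set M} {φ : V → ι → ℝ≥0} {𝒜 : Kind}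

theorem IsLocalChart.comp_homeomorph (hφ : IsLocalChart 𝒜 n S V φ)
    (h : (ι → ℝ≥0) ≃ₜ (κ → ℝ≥0)) (hcard : Fintype.card κ = n)
    (hf : ∀ (g : (κ → ℝ≥0) → ℝ) a, 𝒜.AnalyticAt g (h a) → 𝒜.AnalyticAt (g ∘ h) a)
    (hb : ∀ (g : (ι → ℝ≥0) → ℝ) b, 𝒜.AnalyticAt g (h.symm b) → 𝒜.AnalyticAt (g ∘ h.symm) b) :
    IsLocalChart 𝒜 n S V (h ∘ φ) where
  card_eq := hcard
  isOpen := hφ.isOpen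
  isOpenEmbedding := h.isOpenEmbedding.comp hφ.isOpenEmbedding
  mem_sections_iff U hU f := by
    rw [hφ.mem_sections_iff U hU f]
    constructor
    · rintro ⟨g, hg⟩
      refine ⟨g ∘ h.symm, fun x => ⟨by simp [(hg x).1], hb _ _ ?_⟩⟩
      simpa using (hg x).2
    · rintro ⟨g, hg⟩
      exact ⟨g ∘ h, fun x => ⟨(hg x).1, hf _ _ (hg x).2⟩⟩

theorem IsStdAnalyticAt.reindex (e : κ ≃ ι) {g : (ι → ℝ≥0) → ℝ} {a : κ → ℝ≥0}
    (hg : IsStdAnalyticAt g (a ∘ e.symm)) :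
    IsStdAnalyticAt (fun w : κ → ℝ≥0 => g (w ∘ e.symm)) a := by
  obtain ⟨F, hF, hgF⟩ := hg
  refine ⟨fun z => F (z ∘ e.symm), ?_, ?_⟩
  · let L : (κ → ℝ) →L[ℝ] (ι → ℝ) :=
      ContinuousLinearMap.pi fun i => ContinuousLinearMap.proj (e.symm i)
    exact AnalyticAt.fun_comp (f := L) hF (L.analyticAt _)
  · have hc : Continuous fun w : κ → ℝ≥0 => w ∘ e.symm := by fun_prop
    exact hc.continuousAt.eventually hgF

theorem IsGenAnalyticAt.reindex (e : κ ≃ ι) {g : (ι → ℝ≥0) → ℝ} {a : κ → ℝ≥0}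
    (hg : IsGenAnalyticAt g (a ∘ e.symm)) :
    IsGenAnalyticAt (fun w : κ → ℝ≥0 => g (w ∘ e.symm)) a := by
  obtain ⟨s, ⟨W, hW, hsW⟩, ⟨ρ, hρ, hs⟩, hmix, hsum⟩ := hg
  let E : (κ → ℝ≥0) ≃ (ι → ℝ≥0) := e.arrowCongr (Equiv.refl _)
  refine ⟨fun ν => s (E ν), ⟨W ∘ e, fun k => hW _, fun ν hν k _ => ?_⟩,
    ⟨ρ ∘ e, fun k => hρ _, ?_⟩, fun ν hν k hk => ?_, ?_⟩
  · have := hsW hν (e k) trivial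
    simpa [E] using this
  · refine (E.summable_iff.2 hs).congr fun ν => ?_
    simp only [Function.comp, E]
    rw [← Equiv.prod_comp e]
    simp
  · have := hmix _ hν (e k) (by simpa using hk)
    simpa [E] using this
  · have hc : Continuous fun w : κ → ℝ≥0 => w ∘ e.symm := by fun_prop
    filter_upwards [hc.continuousAt.eventually hsum] with w hw
    refine (E.hasSum_iff.2 hw).congr_fun fun ν => ?_
    simp only [Function.comp, E]
    rw [← Equiv.prod_comp e]
    simp

theorem Kind.AnalyticAt.reindex (e : κ ≃ ι) {g : (ι → ℝ≥0) → ℝ} {a : κ → ℝ≥0}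
    (hg : 𝒜.AnalyticAt g (a ∘ e.symm)) :
    𝒜.AnalyticAt (fun w : κ → ℝ≥0 => g (w ∘ e.symm)) a := by
  cases 𝒜
  · exact IsStdAnalyticAt.reindex e hg
  · exact IsGenAnalyticAt.reindex e hg

theorem IsLocalChart.reindex (hφ : IsLocalChart 𝒜 n S V φ) (e : ι ≃ κ) :
    IsLocalChart 𝒜 n S V fun x => φ x ∘ e.symm := by
  let h : (ι → ℝ≥0) ≃ₜ (κ → ℝ≥0) := Homeomorph.piCongrLeft (Y := fun _ => ℝ≥0) e
  have h1 : ∀ y, h y = y ∘ e.symm := fun y => by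
    funext k
    obtain ⟨i, rfl⟩ := e.surjective k
    exact (Equiv.piCongrLeft_apply_apply (fun _ => ℝ≥0) e y i).trans
      (congrArg y (e.symm_apply_apply i)).symm
  have h2 : ∀ y, h.symm y = y ∘ e := fun y => by
    rw [Homeomorph.symm_apply_eq, h1]
    ext; simp
  convert hφ.comp_homeomorph h (by rw [← hφ.card_eq]; exact (Fintype.card_congr e).symm)
    (fun g a hg => ?_) fun g b hg => ?_ using 1
  · ext x : 1
    exact (h1 _).symm
  · rw [h1] at hg
    simpa [Function.comp_def, h1] using Kind.AnalyticAt.reindex e hg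
  · rw [h2] at hg
    simpa [Function.comp_def, h2] using Kind.AnalyticAt.reindex e.symm hg

theorem IsLocalChart.rpow (hφ : IsLocalChart .generalized n S V φ) {α : ι → ℝ}
    (hα : ∀ i, 0 < α i) : IsLocalChart .generalized n S V fun x i => φ x i ^ α i := by
  let h : (ι → ℝ≥0) ≃ₜ (ι → ℝ≥0) :=
    Homeomorph.piCongrRight fun i => (NNReal.orderIsoRpow (α i) (hα i)).toHomeomorph
  refine hφ.comp_homeomorph h hφ.card_eq (fun g a hg => ?_) fun g b hg => ?_
  · exact IsGenAnalyticAt.comp_rpow hα hg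
  · have h2 : ∀ y, h.symm y = fun i => y i ^ (1 / α i) := fun y => by
      ext i
      rfl
    rw [h2] at hg
    have := IsGenAnalyticAt.comp_rpow (fun i => one_div_pos.2 (hα i)) hg
    have h3 : g ∘ h.symm = fun y => g fun i => y i ^ (1 / α i) := funext fun y => by
      rw [← h2]; rfl
    rw [h3]
    exact this

end ChangeOfCoordinates

/-! ### Boundary components, stars and generic points. -/

section Strata

variable {M : Type*} [TopologicalSpace M] {n : ℕ} {S : FunctionSheaf M}

theorem exists_zero_iff_eq_of_mem_depthLocus_one {x : M}
    (hx : x ∈ depthLocus .generalized n S 1) {ι : Type*} [Fintype ι] {V : Set M}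
    {φ : V → ι → ℝ≥0} (hφ : IsLocalChart .generalized n S V φ) (hxV : x ∈ V) :
    ∃ i₀, ∀ i, φ ⟨x, hxV⟩ i = 0 ↔ i = i₀ := by
  obtain ⟨V', ψ, hx', hψ, hcard⟩ := hx
  obtain ⟨⟨k, hk⟩, huniq⟩ := Nat.card_eq_one_iff_exists.1 hcard
  refine hψ.exists_zero_iff_eq hφ hx' hxV (k₀ := k) fun i => ⟨fun hi => ?_, fun hi => by rwa [hi]⟩
  exact congrArg Subtype.val (huniq ⟨i, hi⟩)

/-- Membership in `depthLocus` is witnessed by some chart, so independence of the chart must be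
proved; codimension one is the only case needed. -/
theorem eq_one_of_mem_depthLocus {x : M} {k : ℕ} (hx : x ∈ depthLocus .generalized n S 1)
    (hk : x ∈ depthLocus .generalized n S k) : k = 1 := by
  obtain ⟨V, φ, hxV, hφ, rfl⟩ := hk
  obtain ⟨i₀, hi₀⟩ := exists_zero_iff_eq_of_mem_depthLocus_one hx hφ hxV
  exact Nat.card_eq_one_iff_exists.2 ⟨⟨i₀, (hi₀ i₀).2 rfl⟩, fun i => Subtype.ext ((hi₀ i).1 i.2)⟩

end Strata

namespace StratifiedGManifold

variable {n : ℕ} {M : Type*} [TopologicalSpace M] {X : StratifiedGManifold n M}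

/-- An open star meeting the closure `E` of a stratum meets the stratum itself. A stratum of the
star through such a point also has codimension one, so it is the same connected component, and `p`
lies in its closure. -/
theorem center_mem_of_mem_star {p x : M} (hopen : IsOpen (X.star p)) (hx : x ∈ X.star p)
    {E : Set M} (hE : E ∈ X.components) (hxE : x ∈ E) : p ∈ E := by
  obtain ⟨T, ⟨y, hy, rfl⟩, rfl⟩ := hE
  obtain ⟨z, hzp, hz⟩ := mem_closure_iff.1 hxE _ hopen hx
  obtain ⟨T', ⟨⟨k, ⟨w, hw, rfl⟩⟩, hp⟩, hzT'⟩ := hzp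
  obtain rfl : k = 1 := eq_one_of_mem_depthLocus
    (connectedComponentIn_subset _ _ hz) (connectedComponentIn_subset _ _ hzT')
  rwa [connectedComponentIn_eq hz, ← connectedComponentIn_eq hzT']

/-- `y` is a point of the open stratum of the boundary component `E`. -/
structure IsGeneric (X : StratifiedGManifold n M) (E : Set M) (y : M) : Prop where
  mem : y ∈ E
  eq_of_mem : ∀ F ∈ X.components, y ∈ F → F = E
  mem_star : ∀ p ∈ E, y ∈ X.star p

end StratifiedGManifold

namespace MonomialGManifold

variable {n : ℕ} {M : Type*} [TopologicalSpace M] {X : MonomialGManifold n M}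

theorem isOpen_star (p : X.corners) : IsOpen (X.star (p : M)) :=
  (X.isMonomialAtlas.isAffineChart p).isChart.isOpen

theorem mem_of_mem_star (p : X.corners) {x : M} (hx : x ∈ X.star (p : M)) {E : Set M}
    (hE : E ∈ X.components) (hxE : x ∈ E) : (p : M) ∈ E :=
  StratifiedGManifold.center_mem_of_mem_star (isOpen_star p) hx hE hxE

/-- Any point of a codimension-one stratum with closure `E` will do: a second component through it
would give a second vanishing coordinate in an affine chart. -/
theorem exists_isGeneric {E : Set M} (hE : E ∈ X.components) : ∃ y, X.IsGeneric E y := by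
  obtain ⟨T, ⟨y, hy, rfl⟩, rfl⟩ := id hE
  have hyE := subset_closure (mem_connectedComponentIn hy)
  refine ⟨y, hyE, fun F hF hyF => ?_, fun p hp =>
    ⟨_, ⟨⟨1, y, hy, rfl⟩, hp⟩, mem_connectedComponentIn hy⟩⟩
  obtain ⟨p, hp⟩ := X.isMonomialAtlas.cover y
  have hpF := mem_of_mem_star p hp hF hyF
  have hpE := mem_of_mem_star p hp hE hyE
  have hc := X.isMonomialAtlas.isAffineChart p
  obtain ⟨i₀, hi₀⟩ := exists_zero_iff_eq_of_mem_depthLocus_one hy hc.isChart hp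
  have h1 := (hi₀ ⟨F, hF, hpF⟩).1 ((hc.label _ _).2 hyF)
  have h2 := (hi₀ ⟨_, hE, hpE⟩).1 ((hc.label _ _).2 hyE)
  exact congrArg Subtype.val (h1.trans h2.symm)

theorem exists_corner_mem {E : Set M} (hE : E ∈ X.components) : ∃ p : X.corners, (p : M) ∈ E := by
  obtain ⟨y, hy⟩ := exists_isGeneric hE
  obtain ⟨p, hp⟩ := X.isMonomialAtlas.cover y
  exact ⟨p, mem_of_mem_star p hp hE hy.mem⟩

end MonomialGManifold

/-! ### Exponents of monomial changes of affine charts, read at generic points. -/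

namespace StratifiedGManifold

open Filter

variable {n : ℕ} {M : Type*} [TopologicalSpace M] {X : StratifiedGManifold n M}

open Classical in
/-- The coordinate `u i`, extended by zero. -/
noncomputable def extendCoord {p : M} (u : X.star p → X.Idx p → ℝ≥0) (i : X.Idx p) (x : M) : ℝ :=
  if hx : x ∈ X.star p then u ⟨x, hx⟩ i else 0

theorem extendCoord_apply {p : M} (u : X.star p → X.Idx p → ℝ≥0) (i : X.Idx p) {x : M}
    (hx : x ∈ X.star p) : extendCoord u i x = u ⟨x, hx⟩ i := dif_pos hx

/-- At a generic point of `E` the coordinate `v i` is nonzero while `u_E = 0`; a nonzero exponent on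
`u_E` would make the product vanish. -/
theorem IsExponentMatrix.eq_zero {p q y : M} {u : X.star p → X.Idx p → ℝ≥0}
    {v : X.star q → X.Idx q → ℝ≥0} {C : X.Idx q → X.Idx p → ℝ} (hC : X.IsExponentMatrix u v C)
    (hu : ∀ (x : X.star p) (F : X.Idx p), u x F = 0 ↔ (x : M) ∈ F.1)
    (hv : ∀ (x : X.star q) (F : X.Idx q), v x F = 0 ↔ (x : M) ∈ F.1)
    {E : Set M} (hy : X.IsGeneric E y) (hE : E ∈ X.components) (hp : p ∈ E) (hq : q ∈ E)
    (i : X.Idx q) (hi : i ≠ ⟨E, hE, hq⟩) : C i ⟨E, hE, hp⟩ = 0 := by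
  have hyp := hy.mem_star p hp
  have hyq := hy.mem_star q hq
  have hvi : v ⟨y, hyq⟩ i ≠ 0 := fun h =>
    hi (Subtype.ext (hy.eq_of_mem _ i.2.1 ((hv _ _).1 h)))
  rw [hC y hyp hyq i, Finset.prod_ne_zero_iff] at hvi
  have h := hvi ⟨E, hE, hp⟩ (Finset.mem_univ _)
  rw [(hu ⟨y, hyp⟩ ⟨E, hE, hp⟩).2 hy.mem] at h
  by_contra h0
  exact h (NNReal.zero_rpow h0)

namespace IsAffineChart

variable {𝒜 : Kind} {S : FunctionSheaf M} {p : M} {u : X.star p → X.Idx p → ℝ≥0}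

theorem continuousAt_extendCoord (hu : X.IsAffineChart 𝒜 S p u) (i : X.Idx p) {x : M}
    (hx : x ∈ X.star p) : ContinuousAt (extendCoord u i) x := by
  have h := hu.isChart.isOpenEmbedding.continuous
  have h2 : ContinuousAt (extendCoord u i ∘ ((↑) : X.star p → M)) ⟨x, hx⟩ := by
    have : extendCoord u i ∘ ((↑) : X.star p → M) = fun z => (u z i : ℝ) :=
      funext fun z => extendCoord_apply u i z.2
    rw [this]
    exact Continuous.continuousAt (by fun_prop)
  exact (hu.isChart.isOpen.isOpenEmbedding_subtypeVal.continuousAt_iff (x := ⟨x, hx⟩)).1 h2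

theorem extendCoord_pos (hu : X.IsAffineChart 𝒜 S p u) (i : X.Idx p) {x : M}
    (hx : x ∈ X.star p) (hxi : x ∉ i.1) : 0 < extendCoord u i x := by
  rw [extendCoord_apply u i hx]
  have := mt (hu.label ⟨x, hx⟩ i).1 hxi
  exact_mod_cast pos_iff_ne_zero.2 this

theorem neBot_nhdsWithin_compl (hu : X.IsAffineChart 𝒜 S p u) {E : Set M} (hE : E ∈ X.components)
    (hp : p ∈ E) {y : M} (hy : y ∈ X.star p) : (𝓝[Eᶜ] y).NeBot := by
  rw [nhdsWithin_neBot]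
  intro t ht
  obtain ⟨x, hx, hxt, h0⟩ := hu.isChart.exists_zero_iff hy (p := (· ∈ t)) ht (J := ∅) (by simp)
  exact ⟨x, hxt, fun hxE => Set.notMem_empty _ <|
    (h0 ⟨E, hE, hp⟩).1 ((hu.label ⟨x, hx⟩ ⟨E, hE, hp⟩).2 hxE)⟩

theorem tendsto_log_extendCoord (hu : X.IsAffineChart 𝒜 S p u) (i : X.Idx p) {y : M}
    (hy : y ∈ X.star p) (hyi : y ∈ i.1) :
    Tendsto (fun x => Real.log (extendCoord u i x)) (𝓝[i.1ᶜ] y) atBot := by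
  refine Real.tendsto_log_nhdsNE_zero.comp (tendsto_nhdsWithin_iff.2 ⟨?_, ?_⟩)
  · have h := (hu.continuousAt_extendCoord i hy).tendsto
    rw [extendCoord_apply u i hy, (hu.label _ _).2 hyi, NNReal.coe_zero] at h
    exact h.mono_left nhdsWithin_le_nhds
  · filter_upwards [eventually_mem_nhdsWithin,
      nhdsWithin_le_nhds (hu.isChart.isOpen.mem_nhds hy)] with x hx hxp
    simpa [extendCoord_apply u i hxp, hu.label] using hx

variable {𝒜' : Kind} {S' : FunctionSheaf M} {q : M} {v : X.star q → X.Idx q → ℝ≥0}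

/-- The diagonal exponent of a component `E` of a monomial change of coordinates is the limit of
a quotient of logarithms at any generic point of `E`. -/
theorem tendsto_log_div_log (hu : X.IsAffineChart 𝒜 S p u) (hv : X.IsAffineChart 𝒜' S' q v)
    {C : X.Idx q → X.Idx p → ℝ} (hC : X.IsExponentMatrix u v C) {E : Set M}
    (hE : E ∈ X.components) (hp : p ∈ E) (hq : q ∈ E) {y : M} (hy : X.IsGeneric E y) :
    Tendsto (fun x => Real.log (extendCoord v ⟨E, hE, hq⟩ x) /
      Real.log (extendCoord u ⟨E, hE, hp⟩ x)) (𝓝[Eᶜ] y) (𝓝 (C ⟨E, hE, hq⟩ ⟨E, hE, hp⟩)) := by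
  classical
  have hyp := hy.mem_star p hp
  have hyq := hy.mem_star q hq
  set e : X.Idx p := ⟨E, hE, hp⟩ with he
  set e' : X.Idx q := ⟨E, hE, hq⟩ with he'
  have hbot : Tendsto (fun x => Real.log (extendCoord u e x)) (𝓝[Eᶜ] y) atBot :=
    hu.tendsto_log_extendCoord e hyp hy.mem
  have hy0 : ∀ j, j ≠ e → extendCoord u j y ≠ 0 := fun j hj => by
    rw [extendCoord_apply u j hyp]
    have := mt (hu.label ⟨y, hyp⟩ j).1 fun h => hj (Subtype.ext (hy.eq_of_mem _ j.2.1 h))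
    exact_mod_cast this
  -- For `j ≠ e` the logarithm converges at `y` while the denominator tends to `-∞`; only the term
  -- `j = e` survives.
  have hterm : ∀ j, Tendsto (fun x => C e' j * (Real.log (extendCoord u j x) /
      Real.log (extendCoord u e x))) (𝓝[Eᶜ] y) (𝓝 (C e' j * if j = e then 1 else 0)) := by
    intro j
    refine Tendsto.const_mul _ ?_
    split_ifs with hj
    · subst hj
      refine tendsto_const_nhds.congr' ?_
      filter_upwards [hbot.eventually_lt_atBot 0] with x hx
      rw [div_self hx.ne]
    · have h1 := ((hu.continuousAt_extendCoord j hyp).log (hy0 j hj)).tendsto.mono_left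
        (nhdsWithin_le_nhds (s := Eᶜ))
      exact h1.div_atBot hbot
  have hsum := tendsto_finsetSum Finset.univ fun j _ => hterm j
  simp only [mul_ite, mul_one, mul_zero, Finset.sum_ite_eq', Finset.mem_univ, if_true] at hsum
  refine hsum.congr' ?_
  have hne : ∀ᶠ x in 𝓝[Eᶜ] y, ∀ j, j ≠ e → extendCoord u j x ≠ 0 :=
    nhdsWithin_le_nhds <| eventually_all.2 fun j => eventually_imp_distrib_left.2 fun hj =>
      (hu.continuousAt_extendCoord j hyp).eventually_ne (hy0 j hj)
  filter_upwards [hne, eventually_mem_nhdsWithin,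
    nhdsWithin_le_nhds (hu.isChart.isOpen.mem_nhds hyp),
    nhdsWithin_le_nhds (hv.isChart.isOpen.mem_nhds hyq)] with x hx hxE hxp hxq
  have hxe : extendCoord u e x ≠ 0 := by
    rw [extendCoord_apply u e hxp]
    have := mt (hu.label ⟨x, hxp⟩ e).1 hxE
    exact_mod_cast this
  have hpos : ∀ j, extendCoord u j x ≠ 0 := fun j => by
    by_cases hj : j = e
    · rwa [hj]
    · exact hx j hj
  have h0 : ∀ j, 0 ≤ extendCoord u j x := fun j => by
    rw [extendCoord_apply u j hxp]; exact NNReal.coe_nonneg _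
  have hprod : extendCoord v e' x = ∏ j, extendCoord u j x ^ C e' j := by
    rw [extendCoord_apply v e' hxq, hC x hxp hxq e']
    push_cast
    refine Finset.prod_congr rfl fun j _ => ?_
    rw [extendCoord_apply u j hxp]
  rw [hprod, Real.log_prod fun j _ => (Real.rpow_pos_of_pos ((h0 j).lt_of_ne' (hpos j)) _).ne',
    Finset.sum_div]
  refine Finset.sum_congr rfl fun j _ => ?_
  rw [Real.log_rpow ((h0 j).lt_of_ne' (hpos j)), mul_div_assoc]

/-- The quotients of logarithms telescope. Working with their limits avoids any uniqueness statement
for the exponent matrices. -/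
theorem exponent_mul_exponent (hu : X.IsAffineChart 𝒜 S p u) (hv : X.IsAffineChart 𝒜' S' q v)
    {𝒜'' : Kind} {S'' : FunctionSheaf M} {r : M} {w : X.star r → X.Idx r → ℝ≥0}
    (hw : X.IsAffineChart 𝒜'' S'' r w)
    {C : X.Idx q → X.Idx p → ℝ} (hC : X.IsExponentMatrix u v C)
    {D : X.Idx r → X.Idx q → ℝ} (hD : X.IsExponentMatrix v w D)
    {B : X.Idx r → X.Idx p → ℝ} (hB : X.IsExponentMatrix u w B) {E : Set M}
    (hE : E ∈ X.components) (hp : p ∈ E) (hq : q ∈ E) (hr : r ∈ E) {y : M}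
    (hy : X.IsGeneric E y) :
    D ⟨E, hE, hr⟩ ⟨E, hE, hq⟩ * C ⟨E, hE, hq⟩ ⟨E, hE, hp⟩ = B ⟨E, hE, hr⟩ ⟨E, hE, hp⟩ := by
  have hC' := hu.tendsto_log_div_log hv hC hE hp hq hy
  have hD' := hv.tendsto_log_div_log hw hD hE hq hr hy
  have hB' := hu.tendsto_log_div_log hw hB hE hp hr hy
  have := hu.neBot_nhdsWithin_compl hE hp (hy.mem_star p hp)
  refine tendsto_nhds_unique ((hD'.mul hC').congr' ?_) hB'
  filter_upwards [(hv.tendsto_log_extendCoord ⟨E, hE, hq⟩ (hy.mem_star q hq)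
    hy.mem).eventually_lt_atBot 0] with x hx
  exact div_mul_div_cancel₀ hx.ne

theorem exponent_self (hu : X.IsAffineChart 𝒜 S p u) {C : X.Idx p → X.Idx p → ℝ}
    (hC : X.IsExponentMatrix u u C) {E : Set M} (hE : E ∈ X.components) (hp : p ∈ E) {y : M}
    (hy : X.IsGeneric E y) : C ⟨E, hE, hp⟩ ⟨E, hE, hp⟩ = 1 := by
  have hC' := hu.tendsto_log_div_log hu hC hE hp hp hy
  have := hu.neBot_nhdsWithin_compl hE hp (hy.mem_star p hp)
  refine tendsto_nhds_unique hC' (tendsto_const_nhds.congr' ?_)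
  filter_upwards [(hu.tendsto_log_extendCoord ⟨E, hE, hp⟩ (hy.mem_star p hp)
    hy.mem).eventually_lt_atBot 0] with x hx
  exact (div_self hx.ne).symm

theorem exponent_nonneg (hu : X.IsAffineChart 𝒜 S p u) (hv : X.IsAffineChart 𝒜' S' q v)
    {C : X.Idx q → X.Idx p → ℝ} (hC : X.IsExponentMatrix u v C) {E : Set M}
    (hE : E ∈ X.components) (hp : p ∈ E) (hq : q ∈ E) {y : M} (hy : X.IsGeneric E y) :
    0 ≤ C ⟨E, hE, hq⟩ ⟨E, hE, hp⟩ := by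
  have := hu.neBot_nhdsWithin_compl hE hp (hy.mem_star p hp)
  refine ge_of_tendsto (hu.tendsto_log_div_log hv hC hE hp hq hy) ?_
  filter_upwards [(hu.tendsto_log_extendCoord ⟨E, hE, hp⟩ (hy.mem_star p hp)
      hy.mem).eventually_lt_atBot 0, (hv.tendsto_log_extendCoord ⟨E, hE, hq⟩ (hy.mem_star q hq)
      hy.mem).eventually_lt_atBot 0] with x hx hx'
  exact (div_pos_of_neg_of_neg hx' hx).le

/-- In standard charts, a boundary coordinate is bounded by a multiple of the corresponding
coordinate of any other chart. -/
theorem eventually_le_mul (hu : X.IsAffineChart .standard S p u)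
    (hv : X.IsAffineChart .standard S q v) {E : Set M}
    (hE : E ∈ X.components) (hp : p ∈ E) (hq : q ∈ E) {y : M} (hy : X.IsGeneric E y) :
    ∃ K : ℝ, ∀ᶠ x in 𝓝 y, extendCoord v ⟨E, hE, hq⟩ x ≤ K * extendCoord u ⟨E, hE, hp⟩ x := by
  classical
  have hyp := hy.mem_star p hp
  have hyq := hy.mem_star q hq
  set e : X.Idx p := ⟨E, hE, hp⟩ with he
  set e' : X.Idx q := ⟨E, hE, hq⟩ with he'
  obtain ⟨g, hg⟩ := hu.isChart.exists_transition hv.isChart e'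
  obtain ⟨F, hF, hgF⟩ : IsStdAnalyticAt g (u ⟨y, hyp⟩) := (hg y hyp hyq).2
  obtain ⟨K, s, hs, hK⟩ := hF.hasStrictFDerivAt.exists_lipschitzOnWith
  have hc : Continuous fun w : X.Idx p → ℝ≥0 => fun i => (w i : ℝ) := by fun_prop
  let good : (X.Idx p → ℝ≥0) → Prop := fun w => g w = F (fun i => (w i : ℝ)) ∧
    (fun i => (w i : ℝ)) ∈ s ∧ ∃ (x : M) (hx : x ∈ X.star p), x ∈ X.star q ∧ u ⟨x, hx⟩ = w
  have hgood : ∀ᶠ w in 𝓝 (u ⟨y, hyp⟩), good w := hgF.and <|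
    (hc.continuousAt.eventually hs).and <|
      hu.isChart.eventually_exists hyp (hv.isChart.isOpen.mem_nhds hyq)
  -- Each point is compared with its projection to the face `u_E = 0`, where the transition
  -- vanishes. The analytic extension is Lipschitz near `y`, and the distance between the two points
  -- is the coordinate `u_E`.
  have hupd : Tendsto (fun w : X.Idx p → ℝ≥0 => Function.update w e 0) (𝓝 (u ⟨y, hyp⟩))
      (𝓝 (u ⟨y, hyp⟩)) := by
    have h := (tendsto_id (x := 𝓝 (u ⟨y, hyp⟩))).update e (tendsto_const_nhds (x := (0 : ℝ≥0)))
    have h0 : u ⟨y, hyp⟩ e = 0 := (hu.label _ _).2 hy.mem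
    have h1 : Function.update (u ⟨y, hyp⟩) e 0 = u ⟨y, hyp⟩ := by
      rw [← h0, Function.update_eq_self]
    simpa [h1] using h
  refine ⟨K, ?_⟩
  filter_upwards [hu.isChart.tendsto hyp (hgood.and (hupd.eventually hgood)),
    hv.isChart.isOpen.mem_nhds hyq] with x ⟨hxp, ⟨h1, h2, _⟩, h3, h4, z, hzp, hzq, hzw⟩ hxq
  have hgz : g (Function.update (u ⟨x, hxp⟩) e 0) = 0 := by
    rw [← hzw, (hg z hzp hzq).1]
    have hz0 : u ⟨z, hzp⟩ e = 0 := by rw [hzw, Function.update_self]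
    have hz0' : v ⟨z, hzq⟩ e' = 0 := (hv.label _ _).2 ((hu.label ⟨z, hzp⟩ e).1 hz0)
    rw [hz0', NNReal.coe_zero]
  have hd := hK.dist_le_mul _ h2 _ h4
  rw [← h1, ← h3, hgz, (hg x hxp hxq).1, Real.dist_eq, sub_zero,
    abs_of_nonneg (NNReal.coe_nonneg _)] at hd
  rw [extendCoord_apply v e' hxq, extendCoord_apply u e hxp]
  refine hd.trans (mul_le_mul_of_nonneg_left ?_ K.2)
  refine (dist_pi_le_iff (NNReal.coe_nonneg _)).2 fun i => ?_
  by_cases hi : i = e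
  · subst hi; simp
  · simp [hi]

/-- From `v_E ≤ K * u_E`, division of `log v_E ≤ log K + log u_E` by the negative number `log u_E`
bounds the quotient below by `1 + log K / log u_E`, which tends to `1`. -/
theorem one_le_exponent (hu : X.IsAffineChart .standard S p u)
    (hv : X.IsAffineChart .standard S q v)
    {C : X.Idx q → X.Idx p → ℝ} (hC : X.IsExponentMatrix u v C) {E : Set M}
    (hE : E ∈ X.components) (hp : p ∈ E) (hq : q ∈ E) {y : M} (hy : X.IsGeneric E y) :
    1 ≤ C ⟨E, hE, hq⟩ ⟨E, hE, hp⟩ := by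
  have := hu.neBot_nhdsWithin_compl hE hp (hy.mem_star p hp)
  obtain ⟨K, hK⟩ := hu.eventually_le_mul hv hE hp hq hy
  have hbot := hu.tendsto_log_extendCoord ⟨E, hE, hp⟩ (hy.mem_star p hp) hy.mem
  have h1 : Tendsto (fun x => Real.log K / Real.log (extendCoord u ⟨E, hE, hp⟩ x) + 1)
      (𝓝[Eᶜ] y) (𝓝 (0 + 1)) := (tendsto_const_nhds.div_atBot hbot).add tendsto_const_nhds
  rw [zero_add] at h1
  refine le_of_tendsto_of_tendsto h1 (hu.tendsto_log_div_log hv hC hE hp hq hy) ?_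
  filter_upwards [hbot.eventually_lt_atBot 0, nhdsWithin_le_nhds hK, eventually_mem_nhdsWithin,
    nhdsWithin_le_nhds (hu.isChart.isOpen.mem_nhds (hy.mem_star p hp)),
    nhdsWithin_le_nhds (hv.isChart.isOpen.mem_nhds (hy.mem_star q hq))] with x hx hxK hxE hxp hxq
  have hu0 := hu.extendCoord_pos ⟨E, hE, hp⟩ hxp hxE
  have hv0 := hv.extendCoord_pos ⟨E, hE, hq⟩ hxq hxE
  have hK0 : 0 < K := pos_of_mul_pos_left (hv0.trans_le hxK) hu0.le
  have hlog := Real.log_le_log hv0 hxK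
  rw [Real.log_mul hK0.ne' hu0.ne'] at hlog
  rw [div_add_one hx.ne]
  exact div_le_div_of_nonpos_of_le hx.le hlog

/-- The diagonal exponents of a monomial change of standard charts are equal to one. -/
theorem exponent_eq_one (hu : X.IsAffineChart .standard S p u)
    (hv : X.IsAffineChart .standard S q v)
    {C : X.Idx q → X.Idx p → ℝ} (hC : X.IsExponentMatrix u v C)
    {D : X.Idx p → X.Idx q → ℝ} (hD : X.IsExponentMatrix v u D)
    {B : X.Idx p → X.Idx p → ℝ} (hB : X.IsExponentMatrix u u B) {E : Set M}
    (hE : E ∈ X.components) (hp : p ∈ E) (hq : q ∈ E) {y : M} (hy : X.IsGeneric E y) :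
    C ⟨E, hE, hq⟩ ⟨E, hE, hp⟩ = 1 := by
  have h1 := hu.one_le_exponent hv hC hE hp hq hy
  have h2 := hv.one_le_exponent hu hD hE hq hp hy
  have h3 := hu.exponent_mul_exponent hv hu hC hD hB hE hp hq hp hy
  rw [hu.exponent_self hB hE hp hy] at h3
  nlinarith

end IsAffineChart

end StratifiedGManifold

/-! ### A monomial atlas determines its sheaf. -/

section Uniqueness

open StratifiedGManifold

variable {n : ℕ} {M : Type*} [TopologicalSpace M] {X : StratifiedGManifold n M}

theorem StratifiedGManifold.IsMonomialAtlas.mem_sections_iff {𝒜 : Kind} {S : FunctionSheaf M}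
    {b : X.CoordFamily} (h : X.IsMonomialAtlas 𝒜 S b) (U : Opens M) (f : C(U, ℝ)) :
    f ∈ S.sections U ↔ ∀ p : X.corners, ∃ g : (X.Idx (p : M) → ℝ≥0) → ℝ,
      ∀ (x : U) (hx : (x : M) ∈ X.star (p : M)),
        g (b p ⟨x, hx⟩) = f x ∧ 𝒜.AnalyticAt g (b p ⟨x, hx⟩) := by
  let V : X.corners → Opens M := fun p => U ⊓ ⟨X.star (p : M), (h.isAffineChart p).isChart.isOpen⟩
  have hV : ∀ p, V p ≤ U := fun p => inf_le_left
  have hV' : ∀ p, (V p : Set M) ⊆ X.star (p : M) := fun p x hx => hx.2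
  have hchart := fun p => (h.isAffineChart p).isChart.mem_sections_iff (V p) (hV' p)
    (f.comp ⟨Set.inclusion (hV p), continuous_inclusion (hV p)⟩)
  constructor
  · intro hf p
    obtain ⟨g, hg⟩ := (hchart p).1 (S.restrict_mem (hV p) f hf)
    exact ⟨g, fun x hx => hg ⟨x, x.2, hx⟩⟩
  · intro hf
    refine S.locality f fun x hx => ?_
    obtain ⟨p, hp⟩ := h.cover x
    obtain ⟨g, hg⟩ := hf p
    exact ⟨V p, hV p, ⟨hx, hp⟩, (hchart p).2 ⟨g, fun y => hg ⟨y, hV p y.2⟩ (hV' p y.2)⟩⟩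

/-- A sheaf is determined by a monomial atlas. -/
theorem StratifiedGManifold.IsMonomialAtlas.sheaf_eq {𝒜 : Kind} {S S' : FunctionSheaf M}
    {b : X.CoordFamily} (h : X.IsMonomialAtlas 𝒜 S b) (h' : X.IsMonomialAtlas 𝒜 S' b) :
    S = S' := by
  ext U f
  rw [h.mem_sections_iff, h'.mem_sections_iff]

end Uniqueness

/-! ### The weight relations: necessity, and construction of a standardization from them. -/

namespace MonomialGManifold

open Filter StratifiedGManifold

variable {n : ℕ} {M : Type*} [TopologicalSpace M] {X : MonomialGManifold n M}

theorem isExponentMatrix_exponentMatrix (p q : X.corners) :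
    X.IsExponentMatrix (X.coord p) (X.coord q) (X.exponentMatrix p q) :=
  Classical.choose_spec (X.isMonomialAtlas.monomial p q)

theorem weight_mul_weight {p q r : X.corners} {E : Set M} (hE : E ∈ X.components)
    (hp : (p : M) ∈ E) (hq : (q : M) ∈ E) (hr : (r : M) ∈ E) :
    X.weight p q E hE hp hq * X.weight q r E hE hq hr = X.weight p r E hE hp hr := by
  obtain ⟨y, hy⟩ := exists_isGeneric hE
  rw [mul_comm]
  exact (X.isMonomialAtlas.isAffineChart p).exponent_mul_exponent
    (X.isMonomialAtlas.isAffineChart q) (X.isMonomialAtlas.isAffineChart r)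
    (isExponentMatrix_exponentMatrix p q) (isExponentMatrix_exponentMatrix q r)
    (isExponentMatrix_exponentMatrix p r) hE hp hq hr hy

theorem weight_self {p : X.corners} {E : Set M} (hE : E ∈ X.components) (hp : (p : M) ∈ E) :
    X.weight p p E hE hp hp = 1 := by
  obtain ⟨y, hy⟩ := exists_isGeneric hE
  exact (X.isMonomialAtlas.isAffineChart p).exponent_self (isExponentMatrix_exponentMatrix p p)
    hE hp hy

/-- As a limit of positive quotients the weight is nonnegative, and it is a factor of `weight p p =
1`. -/
theorem weight_pos {p q : X.corners} {E : Set M} (hE : E ∈ X.components)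
    (hp : (p : M) ∈ E) (hq : (q : M) ∈ E) : 0 < X.weight p q E hE hp hq := by
  obtain ⟨y, hy⟩ := exists_isGeneric hE
  refine lt_of_le_of_ne ((X.isMonomialAtlas.isAffineChart p).exponent_nonneg
    (X.isMonomialAtlas.isAffineChart q) (isExponentMatrix_exponentMatrix p q) hE hp hq hy) ?_
  intro h
  have h1 := weight_mul_weight hE hp hq hp
  change 0 = X.weight p q E hE hp hq at h
  rw [weight_self, ← h, zero_mul] at h1
  exact zero_ne_one h1

theorem isExponentMatrix_rpow {p q : M} {u : X.star p → X.Idx p → ℝ≥0}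
    {v w : X.star q → X.Idx q → ℝ≥0} {C : X.Idx q → X.Idx p → ℝ} (hC : X.IsExponentMatrix u v C)
    {α : X.Idx q → ℝ} (hw : ∀ x i, w x i = v x i ^ α i) :
    X.IsExponentMatrix u w fun i j => C i j * α i := by
  intro x hp hq i
  rw [hw, hC x hp hq i, ← NNReal.finsetProd_rpow]
  simp only [NNReal.rpow_mul]

/-- The exponents of an m-standardization satisfy the weight relations. -/
theorem exponent_eq_weight_mul {s : FunctionSheaf M × X.CoordFamily}
    (hs : s ∈ X.mStandardizations) {α : (p : X.corners) → X.Idx (p : M) → Set.Ioi (0 : ℝ)}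
    (hα : ∀ p, X.HasExponents p (s.2 p) (α p)) (p q : X.corners) {E : Set M}
    (hE : E ∈ X.components) (hp : (p : M) ∈ E) (hq : (q : M) ∈ E) :
    (α p ⟨E, hE, hp⟩ : ℝ) = X.weight p q E hE hp hq * (α q ⟨E, hE, hq⟩ : ℝ) := by
  obtain ⟨y, hy⟩ := exists_isGeneric hE
  have hx := X.isMonomialAtlas.isAffineChart
  have hb := hs.2.1.isAffineChart
  obtain ⟨D, hD⟩ := hs.2.1.monomial p q
  obtain ⟨D', hD'⟩ := hs.2.1.monomial q p
  obtain ⟨B, hB⟩ := hs.2.1.monomial p p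
  have h1 := (hb p).exponent_eq_one (hb q) hD hD' hB hE hp hq hy
  -- The change from `x_p` to `u_q` is compared with the route through `u_p`: the diagonal exponents
  -- are `weight p q * α q`, and `α p` times the exponent `1` between standard charts.
  have hpp := isExponentMatrix_rpow (isExponentMatrix_exponentMatrix p p) (hα p)
  have hpq := isExponentMatrix_rpow (isExponentMatrix_exponentMatrix p q) (hα q)
  have h2 := (hx p).exponent_mul_exponent (hb p) (hb q) hpp hD hpq hE hp hp hq hy
  have h3 := weight_self (p := p) hE hp
  simp only [weight] at h3 ⊢
  rw [h1, h3, one_mul, one_mul] at h2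
  exact h2

theorem isAffineChart_rpow {p : X.corners} {α : X.Idx (p : M) → Set.Ioi (0 : ℝ)}
    {u : X.star (p : M) → X.Idx (p : M) → ℝ≥0} (hu : X.HasExponents p u α) :
    X.IsAffineChart .generalized X.sheaf p u := by
  have hx := X.isMonomialAtlas.isAffineChart p
  have hα : ∀ i, (0 : ℝ) < α i := fun i => (α i).2
  obtain rfl : u = fun x i => X.coord p x i ^ (α i : ℝ) := by
    ext x i; rw [hu x i]
  refine ⟨hx.isChart.rpow hα, fun w => ?_, ?_, fun x E => ?_⟩
  · obtain ⟨x, h⟩ := hx.surjective fun i => w i ^ (1 / (α i : ℝ))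
    refine ⟨x, ?_⟩
    ext i
    simp only [h]
    rw [← NNReal.rpow_mul, one_div, inv_mul_cancel₀ (hα i).ne', NNReal.rpow_one]
  · obtain ⟨hp, h0⟩ := hx.map_center
    refine ⟨hp, ?_⟩
    ext i
    simp [h0, NNReal.zero_rpow (hα i).ne']
  · rw [← hx.label x E]
    simp [NNReal.rpow_eq_zero_iff, (hα E).ne']

theorem exponents_unique {p : X.corners} {α β : X.Idx (p : M) → Set.Ioi (0 : ℝ)}
    {u : X.star (p : M) → X.Idx (p : M) → ℝ≥0} {i : X.Idx (p : M)}
    (hα : ∀ x, u x i = X.coord p x i ^ (α i : ℝ)) (hβ : ∀ x, u x i = X.coord p x i ^ (β i : ℝ)) :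
    α i = β i := by
  -- A point with all coordinates equal to `2` exists; any positive base other than `1` would detect
  -- the exponent.
  obtain ⟨x, hx⟩ := (X.isMonomialAtlas.isAffineChart p).surjective fun _ => 2
  have h := (hα x).symm.trans (hβ x)
  simp only [hx] at h
  have h' : (2 : ℝ) ^ (α i : ℝ) = 2 ^ (β i : ℝ) := by
    simpa only [NNReal.coe_rpow, NNReal.coe_ofNat] using congrArg NNReal.toReal h
  exact Subtype.ext ((Real.rpow_right_inj two_pos (by norm_num)).1 h')

/-- The functions whose germs are standard analytic in all the coordinates of the family `b`. -/
def stdSheaf (X : MonomialGManifold n M) (b : X.CoordFamily) : FunctionSheaf M where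
  sections U := {f | ∀ (p : X.corners) (x : M) (_ : x ∈ U) (hp : x ∈ X.star (p : M)),
    ∃ F : (X.Idx (p : M) → ℝ) → ℝ, AnalyticAt ℝ F (fun i => (b p ⟨x, hp⟩ i : ℝ)) ∧
      ∀ᶠ y in 𝓝 x, ∀ (hy : y ∈ U) (hy' : y ∈ X.star (p : M)),
        f ⟨y, hy⟩ = F fun i => (b p ⟨y, hy'⟩ i : ℝ)}
  restrict_mem {U V} h f hf p x hx hp := by
    obtain ⟨F, hF, hfF⟩ := hf p x (h hx) hp
    exact ⟨F, hF, hfF.mono fun y hy hyV hy' => hy (h hyV) hy'⟩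
  locality {U} f hf p x hx hp := by
    obtain ⟨V, h, hxV, hfV⟩ := hf x hx
    obtain ⟨F, hF, hfF⟩ := hfV p x hxV hp
    refine ⟨F, hF, ?_⟩
    filter_upwards [hfF, V.isOpen.mem_nhds hxV] with y hy hyV _ hy'
    exact hy hyV hy'

/-- The changes of coordinates of the family `b` are standard analytic. -/
def HasAnalyticTransitions (X : MonomialGManifold n M) (b : X.CoordFamily) : Prop :=
  ∀ (p q : X.corners) (x : M) (hp : x ∈ X.star (p : M)), x ∈ X.star (q : M) →
    ∀ i : X.Idx (q : M), ∃ T : (X.Idx (p : M) → ℝ) → ℝ,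
      AnalyticAt ℝ T (fun j => (b p ⟨x, hp⟩ j : ℝ)) ∧
      ∀ (y : M) (hy : y ∈ X.star (p : M)) (hy' : y ∈ X.star (q : M)),
        (b q ⟨y, hy'⟩ i : ℝ) = T fun j => (b p ⟨y, hy⟩ j : ℝ)

/-- A section of `stdSheaf` is analytic in every chart of the family, so only the converse needs an
argument: analyticity in one chart passes to the others through the transitions. -/
theorem isLocalChart_stdSheaf {b : X.CoordFamily}
    (hb : ∀ p : X.corners, X.IsAffineChart .generalized X.sheaf p (b p))
    (hT : X.HasAnalyticTransitions b) (p : X.corners) :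
    IsLocalChart .standard n (X.stdSheaf b) (X.star (p : M)) (b p) where
  card_eq := (hb p).isChart.card_eq
  isOpen := (hb p).isChart.isOpen
  isOpenEmbedding := (hb p).isChart.isOpenEmbedding
  mem_sections_iff U hU f := by
    constructor
    · intro hf
      have hinj : Function.Injective fun x : U => b p ⟨x, hU x.2⟩ := fun x y h =>
        Subtype.ext (Subtype.mk.inj ((hb p).isChart.isOpenEmbedding.injective h))
      -- The value `0` off the image of `U` is harmless, since that image is open and only germs at
      -- its points matter.
      refine ⟨Function.extend (fun x : U => b p ⟨x, hU x.2⟩) f 0, fun x =>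
        ⟨hinj.extend_apply f 0 x, ?_⟩⟩
      obtain ⟨F, hF, hfF⟩ := hf p x x.2 (hU x.2)
      refine ⟨F, hF, ?_⟩
      filter_upwards [(hb p).isChart.eventually_exists (hU x.2)
        (hfF.and (U.isOpen.mem_nhds x.2))] with w hw
      obtain ⟨y, hy, ⟨hyF, hyU⟩, rfl⟩ := hw
      rw [← hyF hyU hy]
      exact hinj.extend_apply f 0 ⟨y, hyU⟩
    · rintro ⟨g, hg⟩ q x hx hq
      obtain ⟨F, hF, hgF⟩ := (hg ⟨x, hx⟩).2
      choose T hTan hT using hT q p x hq (hU hx)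
      refine ⟨fun z => F fun i => T i z, ?_, ?_⟩
      · refine AnalyticAt.fun_comp (f := fun z i => T i z) ?_ (analyticAt_pi_iff.2 hTan)
        simp only [← hT _ x hq (hU hx)]
        exact hF
      · filter_upwards [(hb p).isChart.tendsto (hU hx) hgF] with y ⟨hyp, hyF⟩ hyU hyq
        simp only [← hT _ y hyq hyp]
        rw [← hyF]
        exact (hg ⟨y, hyU⟩).1.symm

theorem isStandardization_stdSheaf {b : X.CoordFamily}
    (hb : ∀ p : X.corners, X.IsAffineChart .generalized X.sheaf p (b p))
    (hT : X.HasAnalyticTransitions b) : IsStandardization n X.sheaf (X.stdSheaf b) := by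
  have hc := isLocalChart_stdSheaf hb hT
  refine ⟨fun U f hf => ?_, ⟨X.isManifold.t2, X.isManifold.secondCountable, fun x => ?_⟩,
    fun x => ?_⟩
  · refine X.sheaf.locality f fun x hx => ?_
    obtain ⟨p, hp⟩ := X.isMonomialAtlas.cover x
    let V : Opens M := U ⊓ ⟨X.star (p : M), isOpen_star p⟩
    have hV : V ≤ U := inf_le_left
    have hV' : (V : Set M) ⊆ X.star (p : M) := fun x hx => hx.2
    refine ⟨V, hV, ⟨hx, hp⟩, ?_⟩
    obtain ⟨g, hg⟩ := ((hc p).mem_sections_iff V hV' _).1 ((X.stdSheaf b).restrict_mem hV f hf)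
    exact ((hb p).isChart.mem_sections_iff V hV' _).2
      ⟨g, fun y => ⟨(hg y).1, IsStdAnalyticAt.isGenAnalyticAt (hg y).2⟩⟩
  · obtain ⟨p, hp⟩ := X.isMonomialAtlas.cover x
    exact ⟨_, _, hp, (hc p).reindex (Fintype.equivFinOfCardEq (hc p).card_eq)⟩
  · obtain ⟨p, hp⟩ := X.isMonomialAtlas.cover x
    exact ⟨_, _, hp, (hc p).reindex (Fintype.equivFinOfCardEq (hc p).card_eq),
      (hb p).isChart.reindex (Fintype.equivFinOfCardEq (hc p).card_eq)⟩

/-- The coordinates `x_{p,E}^{α_{p,E}}`. -/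
noncomputable def rpowCoord (X : MonomialGManifold n M)
    (α : (p : X.corners) → X.Idx (p : M) → Set.Ioi (0 : ℝ)) : X.CoordFamily :=
  fun p x i => X.coord p x i ^ (α p i : ℝ)

theorem isExponentMatrix_rpowCoord (α : (p : X.corners) → X.Idx (p : M) → Set.Ioi (0 : ℝ))
    (p q : X.corners) : X.IsExponentMatrix (X.rpowCoord α p) (X.rpowCoord α q)
      fun i j => X.exponentMatrix p q i j * α q i / α p j := by
  intro x hp hq i
  rw [isExponentMatrix_rpow (w := X.rpowCoord α q) (α := fun i => α q i)
    (isExponentMatrix_exponentMatrix p q) (fun _ _ => rfl) x hp hq i]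
  refine Finset.prod_congr rfl fun j _ => ?_
  simp only [rpowCoord]
  rw [← NNReal.rpow_mul, mul_div_cancel₀ _ (ne_of_gt (α p j).2)]

theorem hasAnalyticTransitions_rpowCoord
    {α : (p : X.corners) → X.Idx (p : M) → Set.Ioi (0 : ℝ)}
    (hα : ∀ (p q : X.corners) (E : Set M) (hE : E ∈ X.components)
      (hp : (p : M) ∈ E) (hq : (q : M) ∈ E),
      (α p ⟨E, hE, hp⟩ : ℝ) = X.weight p q E hE hp hq * (α q ⟨E, hE, hq⟩ : ℝ)) :
    X.HasAnalyticTransitions (X.rpowCoord α) := by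
  intro p q x hp hq i
  have hD := isExponentMatrix_rpowCoord α p q
  set D : X.Idx (q : M) → X.Idx (p : M) → ℝ :=
    fun i j => X.exponentMatrix p q i j * α q i / α p j with hDdef
  have hb : ∀ p : X.corners, X.IsAffineChart .generalized X.sheaf p (X.rpowCoord α p) :=
    fun p => isAffineChart_rpow (α := α p) fun _ _ => rfl
  refine ⟨fun z => ∏ j, z j ^ D i j, ?_, fun y hy hy' => ?_⟩
  · refine Finset.analyticAt_fun_prod _ fun j _ => ?_
    have hproj : AnalyticAt ℝ (fun z : X.Idx (p : M) → ℝ => z j)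
        (fun j => (X.rpowCoord α p ⟨x, hp⟩ j : ℝ)) :=
      (ContinuousLinearMap.proj (R := ℝ) (φ := fun _ : X.Idx (p : M) => ℝ) j).analyticAt _
    by_cases hxj : x ∈ j.1
    · have hqj : (q : M) ∈ j.1 := mem_of_mem_star q hq j.2.1 hxj
      obtain ⟨y, hy⟩ := exists_isGeneric j.2.1
      by_cases hi : i = ⟨j.1, j.2.1, hqj⟩
      · have : D i j = 1 := by
          have h := hα p q j.1 j.2.1 j.2.2 hqj
          subst hi
          simp only [hDdef]
          rw [div_eq_one_iff_eq (ne_of_gt (α p j).2)]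
          exact h.symm
        simpa [this] using hproj
      · have : D i j = 0 := hD.eq_zero (hb p).label (hb q).label hy j.2.1 j.2.2 hqj i hi
        simpa [this] using analyticAt_const
    · have hpos : (0 : ℝ) < X.rpowCoord α p ⟨x, hp⟩ j := by
        have := mt ((hb p).label ⟨x, hp⟩ j).1 hxj
        exact_mod_cast pos_iff_ne_zero.2 this
      exact AnalyticAt.fun_comp (g := fun t : ℝ => t ^ D i j) (analyticAt_rpow_const hpos _) hproj
  · rw [hD y hy hy' i]
    push_cast
    rfl

/-- Exponents that satisfy the weight relations define an m-standardization. -/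
theorem mem_mStandardizations {α : (p : X.corners) → X.Idx (p : M) → Set.Ioi (0 : ℝ)}
    (hα : ∀ (p q : X.corners) (E : Set M) (hE : E ∈ X.components)
      (hp : (p : M) ∈ E) (hq : (q : M) ∈ E),
      (α p ⟨E, hE, hp⟩ : ℝ) = X.weight p q E hE hp hq * (α q ⟨E, hE, hq⟩ : ℝ)) :
    (X.stdSheaf (X.rpowCoord α), X.rpowCoord α) ∈ X.mStandardizations := by
  have hb : ∀ p : X.corners, X.IsAffineChart .generalized X.sheaf p (X.rpowCoord α p) :=
    fun p => isAffineChart_rpow (α := α p) fun _ _ => rfl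
  have hT := hasAnalyticTransitions_rpowCoord hα
  refine ⟨isStandardization_stdSheaf hb hT, ⟨fun p => ?_, X.isMonomialAtlas.cover,
    fun p q => ⟨_, isExponentMatrix_rpowCoord α p q⟩⟩, fun p => ⟨hb p, α p, fun _ _ => rfl⟩⟩
  exact ⟨isLocalChart_stdSheaf hb hT p, (hb p).surjective, (hb p).map_center, (hb p).label⟩

end MonomialGManifold

/-! ### Parametrization of the m-standardizations and of the extensions. -/

namespace MonomialGManifold

variable {n : ℕ} {M : Type*} [TopologicalSpace M] {X : MonomialGManifold n M}

/-- The exponents of an m-standardization. -/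
noncomputable def exponents (s : X.mStandardizations) (p : X.corners) :
    X.Idx (p : M) → Set.Ioi (0 : ℝ) :=
  (s.2.2.2 p).exists_exponents.choose

theorem hasExponents_exponents (s : X.mStandardizations) (p : X.corners) :
    X.HasExponents p (s.1.2 p) (exponents s p) :=
  (s.2.2.2 p).exists_exponents.choose_spec

theorem exponents_eq_weight_mul (s : X.mStandardizations) (p q : X.corners) {E : Set M}
    (hE : E ∈ X.components) (hp : (p : M) ∈ E) (hq : (q : M) ∈ E) :
    (exponents s p ⟨E, hE, hp⟩ : ℝ) =
      X.weight p q E hE hp hq * (exponents s q ⟨E, hE, hq⟩ : ℝ) :=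
  exponent_eq_weight_mul s.2 (hasExponents_exponents s) p q hE hp hq

theorem exponents_eq {s : X.mStandardizations} {p : X.corners}
    {α : X.Idx (p : M) → Set.Ioi (0 : ℝ)} (hα : X.HasExponents p (s.1.2 p) α) :
    exponents s p = α :=
  funext fun i => exponents_unique (fun x => hasExponents_exponents s p x i) fun x => hα x i

/-- An m-standardization is determined by one exponent for each boundary component. -/
theorem eq_of_exponents_eq {s t : X.mStandardizations}
    (h : ∀ (E : Set M) (hE : E ∈ X.components), ∃ (r : X.corners) (hr : (r : M) ∈ E),
      exponents s r ⟨E, hE, hr⟩ = exponents t r ⟨E, hE, hr⟩) : s = t := by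
  have hexp : ∀ p, exponents s p = exponents t p := fun p => by
    funext ⟨E, hE, hp⟩
    obtain ⟨r, hr, h⟩ := h E hE
    refine Subtype.ext ?_
    have h1 := exponents_eq_weight_mul s p r hE hp hr
    have h2 := exponents_eq_weight_mul t p r hE hp hr
    rw [h, ← h2] at h1
    exact h1
  have hcoord : s.1.2 = t.1.2 := by
    funext p x i
    rw [hasExponents_exponents s p x i, hasExponents_exponents t p x i, hexp p]
  refine Subtype.ext (Prod.ext ?_ hcoord)
  have h1 := s.2.2.1
  rw [hcoord] at h1
  exact h1.sheaf_eq t.2.2.1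

/-- The values prescribed at the corners `q E` are transported to all corners of `E` by the weights;
multiplicativity of the weights gives the relations. -/
theorem exists_mStandardization_exponents {q : X.components → X.corners}
    (hq : ∀ E : X.components, (q E : M) ∈ (E : Set M)) (a : X.components → Set.Ioi (0 : ℝ)) :
    ∃ s : X.mStandardizations, ∀ (p : X.corners) (E : Set M) (hE : E ∈ X.components)
      (hp : (p : M) ∈ E), (exponents s p ⟨E, hE, hp⟩ : ℝ) =
        X.weight p (q ⟨E, hE⟩) E hE hp (hq ⟨E, hE⟩) * (a ⟨E, hE⟩ : ℝ) := by
  let α : (p : X.corners) → X.Idx (p : M) → Set.Ioi (0 : ℝ) := fun p i =>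
    ⟨X.weight p (q ⟨i.1, i.2.1⟩) i.1 i.2.1 i.2.2 (hq ⟨i.1, i.2.1⟩) * (a ⟨i.1, i.2.1⟩ : ℝ),
      mul_pos (weight_pos _ _ _) (a ⟨i.1, i.2.1⟩).2⟩
  refine ⟨⟨_, mem_mStandardizations (α := α) fun p r E hE hp hr => ?_⟩, fun p E hE hp => ?_⟩
  · simp only [α]
    rw [← mul_assoc, weight_mul_weight]
  · rw [exponents_eq (α := α p) fun _ _ => rfl]

theorem weight_of_eq {p r : X.corners} (h : r = p) {E : Set M} (hE : E ∈ X.components)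
    (hp : (p : M) ∈ E) (hr : (r : M) ∈ E) : X.weight p r E hE hp hr = 1 := by
  subst h
  exact weight_self hE hr

/-- The exponents at chosen corners of the boundary components parametrize the
m-standardizations. -/
theorem exists_equiv_mStandardizations (q : X.components → X.corners)
    (hq : ∀ E : X.components, (q E : M) ∈ (E : Set M)) :
    ∃ Φ : X.mStandardizations ≃ (X.components → Set.Ioi (0 : ℝ)),
      ∀ s E, Φ s E = exponents s (q E) ⟨E, E.2, hq E⟩ := by
  refine ⟨Equiv.ofBijective (fun s E => exponents s (q E) ⟨E, E.2, hq E⟩) ⟨fun s t h => ?_,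
    fun a => ?_⟩, fun _ _ => rfl⟩
  · exact eq_of_exponents_eq fun E hE => ⟨q ⟨E, hE⟩, hq ⟨E, hE⟩, congrFun h ⟨E, hE⟩⟩
  · obtain ⟨s, hs⟩ := exists_mStandardization_exponents hq a
    refine ⟨s, funext fun E => Subtype.ext ?_⟩
    have h := hs (q E) E E.2 (hq E)
    rw [h, weight_of_eq rfl, one_mul]

/-- The exponents at chosen corners of the boundary components that avoid `p` parametrize the
extensions of a local m-standardization at `p`. -/
theorem exists_equiv_extensions {p : X.corners}
    {u : X.star (p : M) → X.Idx (p : M) → ℝ≥0} (hu : X.IsLocalMStandardization p u)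
    (q : {E : X.components // (p : M) ∉ (E : Set M)} → X.corners)
    (hq : ∀ E, (q E : M) ∈ (E.1 : Set M)) :
    ∃ Φ : X.extensions p u ≃ ({E : X.components // (p : M) ∉ (E : Set M)} → Set.Ioi (0 : ℝ)),
      ∀ s E, Φ s E = exponents ⟨s.1, s.2.1⟩ (q E) ⟨E.1, E.1.2, hq E⟩ := by
  obtain ⟨α, hα⟩ := hu.exists_exponents
  refine ⟨Equiv.ofBijective
    (fun s E => exponents ⟨s.1, s.2.1⟩ (q E) ⟨E.1, E.1.2, hq E⟩) ⟨fun s t h => ?_,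
    fun a => ?_⟩, fun _ _ => rfl⟩
  · have hexp : ∀ s : X.extensions p u, exponents ⟨s.1, s.2.1⟩ p = α := fun s =>
      exponents_eq (by rw [s.2.2]; exact hα)
    have hst : (⟨s.1, s.2.1⟩ : X.mStandardizations) = ⟨t.1, t.2.1⟩ := by
      refine eq_of_exponents_eq fun E hE => ?_
      by_cases hp : (p : M) ∈ E
      · exact ⟨p, hp, by rw [hexp, hexp]⟩
      · exact ⟨q ⟨⟨E, hE⟩, hp⟩, hq ⟨⟨E, hE⟩, hp⟩, congrFun h ⟨⟨E, hE⟩, hp⟩⟩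
    exact Subtype.ext (Subtype.mk.inj hst)
  · have hdata : ∀ E : X.components, ∃ (r : X.corners) (c : Set.Ioi (0 : ℝ)),
        (r : M) ∈ (E : Set M) ∧ (∀ hp : (p : M) ∈ (E : Set M), r = p ∧ c = α ⟨E, E.2, hp⟩) ∧
        ∀ hp : (p : M) ∉ (E : Set M), r = q ⟨E, hp⟩ ∧ c = a ⟨E, hp⟩ := fun E => by
      by_cases hp : (p : M) ∈ (E : Set M)
      · exact ⟨p, α ⟨E, E.2, hp⟩, hp, fun _ => ⟨rfl, rfl⟩, fun h => absurd hp h⟩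
      · exact ⟨q ⟨E, hp⟩, a ⟨E, hp⟩, hq ⟨E, hp⟩, fun h => absurd h hp, fun _ => ⟨rfl, rfl⟩⟩
    choose r c hr hrp hrq using hdata
    obtain ⟨s, hs⟩ := exists_mStandardization_exponents hr c
    have hsu : s.1.2 p = u := by
      funext x i
      have h := hs p i.1 i.2.1 i.2.2
      rw [weight_of_eq (hrp _ i.2.2).1, one_mul, (hrp _ i.2.2).2] at h
      rw [hasExponents_exponents s p x i, hα x i]
      exact congrArg (X.coord p x i ^ ·) h
    refine ⟨⟨s.1, s.2, hsu⟩, funext fun E => Subtype.ext ?_⟩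
    have h := hs (q E) E.1 E.1.2 (hq E)
    rw [weight_of_eq (hrq E.1 E.2).1, one_mul, (hrq E.1 E.2).2] at h
    exact h

theorem card_idx (p : X.corners) : Nat.card (X.Idx (p : M)) = n := by
  rw [Nat.card_eq_fintype_card]
  exact (X.isMonomialAtlas.isAffineChart p).isChart.card_eq

theorem finite_components' : Finite X.components := X.finite_components.to_subtype

theorem card_components : Nat.card X.components = X.numComponents := rfl

theorem card_components_mem (p : X.corners) :
    Nat.card {E : X.components // (p : M) ∈ (E : Set M)} = n :=
  (Nat.card_congr (Equiv.subtypeSubtypeEquivSubtypeInter (· ∈ X.components) ((p : M) ∈ ·))).trans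
    (card_idx p)

theorem le_numComponents : n ≤ X.numComponents := by
  obtain ⟨p, hp⟩ := X.exists_corner
  have := X.finite_components'
  exact (card_components_mem (X := X) ⟨p, hp⟩).ge.trans (Finite.card_subtype_le _)

theorem card_components_notMem (p : X.corners) :
    Nat.card {E : X.components // (p : M) ∉ (E : Set M)} = X.numComponents - n := by
  classical
  have := X.finite_components'
  have := Fintype.ofFinite X.components
  have h1 := card_components_mem p
  have h2 := card_components (X := X)
  have h3 := Fintype.card_subtype_compl fun E : X.components => (p : M) ∈ (E : Set M)
  simp only [Nat.card_eq_fintype_card] at h1 h2 ⊢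
  rw [h3, h2]
  exact congrArg (X.numComponents - ·) h1

end MonomialGManifold

end GenAnalytic

/-- (a), (b): the bijections; each is followed by its explicit form, given by the exponents at
chosen corner points `q E ∈ E`. (c): the collections of exponents that come from
m-standardizations. -/
theorem proposition3p6 {n : ℕ} {M : Type*} [TopologicalSpace M]
    (X : GenAnalytic.MonomialGManifold n M) :
    (Nonempty (X.mStandardizations ≃ (Fin X.numComponents → Set.Ioi (0 : ℝ))) ∧
      ∀ (q : X.components → X.corners) (hq : ∀ E : X.components, (q E : M) ∈ (E : Set M)),
        ∃ Φ : X.mStandardizations ≃ (X.components → Set.Ioi (0 : ℝ)),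
          ∀ (s : X.mStandardizations) (E : X.components) (x : X.star (q E : M)),
            s.1.2 (q E) x ⟨E, E.2, hq E⟩ =
              X.coord (q E) x ⟨E, E.2, hq E⟩ ^ (Φ s E : ℝ)) ∧
    (n ≤ X.numComponents ∧
      ∀ (p : X.corners) (u : X.star (p : M) → X.Idx (p : M) → NNReal),
        X.IsLocalMStandardization p u →
        Nonempty ((Fin (X.numComponents - n) → Set.Ioi (0 : ℝ)) ≃ X.extensions p u) ∧
        ∀ (q : {E : X.components // (p : M) ∉ (E : Set M)} → X.corners)
          (hq : ∀ E, (q E : M) ∈ (E.1 : Set M)),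
          ∃ Φ : X.extensions p u ≃
              ({E : X.components // (p : M) ∉ (E : Set M)} → Set.Ioi (0 : ℝ)),
            ∀ (s : X.extensions p u) (E : {E : X.components // (p : M) ∉ (E : Set M)})
              (x : X.star (q E : M)),
              s.1.2 (q E) x ⟨E.1, E.1.2, hq E⟩ =
                X.coord (q E) x ⟨E.1, E.1.2, hq E⟩ ^ (Φ s E : ℝ)) ∧
    (∀ α : (p : X.corners) → X.Idx (p : M) → Set.Ioi (0 : ℝ),
      (∃ s ∈ X.mStandardizations, ∀ p, X.HasExponents p (s.2 p) (α p)) ↔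
        ∀ (p q : X.corners) (E : Set M) (hE : E ∈ X.components)
          (hp : (p : M) ∈ E) (hq : (q : M) ∈ E),
          (α p ⟨E, hE, hp⟩ : ℝ) = X.weight p q E hE hp hq * (α q ⟨E, hE, hq⟩ : ℝ)) := by
  open GenAnalytic GenAnalytic.MonomialGManifold in
  have hfin := X.finite_components'
  have hcorner : ∀ E : X.components, ∃ p : X.corners, (p : M) ∈ (E : Set M) :=
    fun E => exists_corner_mem E.2
  choose c hc using hcorner
  refine ⟨⟨?_, fun q hq => ?_⟩, ⟨le_numComponents, fun p u hu => ⟨?_, fun q hq => ?_⟩⟩,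
    fun α => ⟨?_, fun hα => ?_⟩⟩
  · obtain ⟨Φ, -⟩ := exists_equiv_mStandardizations c hc
    exact ⟨Φ.trans (Equiv.arrowCongr (Finite.equivFinOfCardEq card_components) (Equiv.refl _))⟩
  · obtain ⟨Φ, hΦ⟩ := exists_equiv_mStandardizations q hq
    refine ⟨Φ, fun s E x => ?_⟩
    rw [hΦ]
    exact hasExponents_exponents s (q E) x _
  · obtain ⟨Φ, -⟩ := exists_equiv_extensions hu (fun E => c E.1) fun E => hc E.1
    exact ⟨(Φ.trans (Equiv.arrowCongr (Finite.equivFinOfCardEq (card_components_notMem p))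
      (Equiv.refl _))).symm⟩
  · obtain ⟨Φ, hΦ⟩ := exists_equiv_extensions hu q hq
    refine ⟨Φ, fun s E x => ?_⟩
    rw [hΦ]
    exact hasExponents_exponents ⟨s.1, s.2.1⟩ (q E) x _
  · rintro ⟨s, hs, hα⟩ p q E hE hp hq
    exact exponent_eq_weight_mul hs hα p q hE hp hq
  · exact ⟨_, mem_mStandardizations hα, fun p x E => rfl⟩
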